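/- Let $\mathcal G=(\mathcal V,\mathcal E)$ be a finite directed acyclic network (parallel links allowed), with link capacities $c_e$, a source $s$, a sink $d\neq s$, and a collection $\mathcal W$ of sets $\mathcal A\subseteq\mathcal E$ of links that a wiretapper may observe. Let $R_s\ge 0$ (message rate), $R_{w,v}\ge0$ for $v\in\mathcal V$ (rate of the random key injected at $v$) and $z_e\ge0$ for $e\in\mathcal E$ (transmission rate on $e$) be given. The augmented network is obtained from $\mathcal G$ by placing a new node $v_e$ in the middle of each link $e=(i,j)$, so that $e$ is replaced by links $(i,v_e)$ and $(v_e,j)$ of capacity $z_e$, and by adding for each $\mathcal A\in\mathcal W$ a virtual sink $d^{\mathcal A}$ and, for each $e\in\mathcal A$, a link $(v_e,d^{\mathcal A})$ of capacity $z_e$. Put $R_{w,i}=0$ for the new nodes $i$. For a function on links, its net outflow at a node is the sum of its values over the outgoing links minus the sum over the incoming links. The rates $(R_s,R_w,z)$ are called *feasible* if $z_e\le c_e$ for all $e\in\mathcal E$ and there are - for each $\mathcal A\in\mathcal W$ a function $f^{\mathcal A}$ on the links of the augmented network, with values between $0$ and the link's capacity, whose net outflow is $-\sum_{e\in\mathcal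 A}z_e$ at $d^{\mathcal A}$ and at most $R_{w,i}$ at every other node $i$; and - a function $f^d$ on $\mathcal E$ with $0\le f^d_e\le z_e$, whose net outflow is $-(R_s+\sum_{v\ne d}R_{w,v})$ at $d$, $R_s+R_{w,s}$ at $s$, and $R_{w,i}$ at every other node $i$. A *code* with message alphabet $M$, key alphabets $K_v$ ($v\in\mathcal V$) and link alphabets $X_e$ ($e\in\mathcal E$) determines the symbol on each link $e$ as a function of the symbols received by the tail of $e$, the key of the tail of $e$, and, only if the tail of $e$ is $s$, the message; and it contains a decoding map at $d$ acting on the symbols that $d$ receives. The keys are uniformly distributed on the $K_v$, independent of each other and of the message. The code is *decodable* if for all values of the message and the keys the sink recovers exactly the message and the keys of all nodes $v\neq d$. It is *perfectly secret* if for each $\mathcal A\in\mathcal W$ and each distribution of the message on $M$, the message has zero mutual information with the symbols on the links of $\mathcal A$. Then the following hold. 1. If $(R_s,R_w,z)$ is feasible and consists of integers, then for every sufficiently large finite field $F$ there is a decodable and perfectly secret code with $M=F^{R_s}$, $K_v=F^{R_{w,v}}$ and $X_e=F^{z_e}$, all of whose encoding maps and whose decoding map are $F$-linear. 2. If $(R_s,R_w,z)$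 is feasible (with arbitrary real rates), then for every $\varepsilon>0$ and every sufficiently large blocklength $n$ there is a decodable and perfectly secret code with $2^{n(R_s-\varepsilon)}\le|M|\le2^{nR_s}$, with $2^{n(R_{w,v}-\varepsilon)}\le|K_v|\le2^{nR_{w,v}}$ for all $v\in\mathcal V$, and with $|X_e|\le2^{nz_e}$ for all $e\in\mathcal E$. -/

import Mathlib

namespace SecureNetwork

/-- A network with node set `V` and link set `E`: link `e` goes from `tail e` to `head e`.
Parallel links are allowed; a simple digraph is the case where `E` is a set of ordered pairs. -/
structure Network (V E : Type*) where
  tail : E → V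
  head : E → V

/-- There is no directed cycle. -/
def Network.Acyclic {V E : Type*} (G : Network V E) : Prop :=
  ∀ v, ¬ Relation.TransGen (fun u w => ∃ e, G.tail e = u ∧ G.head e = w) v v

/-- Outflow minus inflow of the link function `f` at the node `v`. -/
def Network.netOut {V E : Type*} [DecidableEq V] [Fintype E] (G : Network V E)
    (f : E → ℝ) (v : V) : ℝ :=
  (∑ e with G.tail e = v, f e) - ∑ e with G.head e = v, f e

/-! ### The network augmented by one virtual sink for each wiretap set -/

/-- Nodes of the augmented network: the original nodes, a node on each original link, and a
virtual sink for each wiretap set. -/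
abbrev AugNode (V : Type*) {E : Type*} (W : Finset (Finset E)) := V ⊕ E ⊕ {A // A ∈ W}

/-- Links of the augmented network: the first and the second half of each original link, and
for each wiretap set `A` and each `e ∈ A` a link from the middle of `e` to the sink of `A`. -/
abbrev AugLink {E : Type*} (W : Finset (Finset E)) :=
  E ⊕ E ⊕ (Σ A : {A // A ∈ W}, {e // e ∈ A.1})

/-- The virtual sink of the wiretap set `A`. -/
abbrev virtualSink (V : Type*) {E : Type*} {W : Finset (Finset E)} (A : {A // A ∈ W}) :
    AugNode V W := Sum.inr (Sum.inr A)

/-- The augmented network. -/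
def Network.augment {V E : Type*} (G : Network V E) (W : Finset (Finset E)) :
    Network (AugNode V W) (AugLink W) where
  tail := Sum.elim (fun e => Sum.inl (G.tail e))
    (Sum.elim (fun e => Sum.inr (Sum.inl e)) (fun t => Sum.inr (Sum.inl t.2.1)))
  head := Sum.elim (fun e => Sum.inr (Sum.inl e))
    (Sum.elim (fun e => Sum.inl (G.head e)) (fun t => virtualSink V t.1))

/-- The capacity of a link of the augmented network is that of the underlying original link. -/
def augCap {E : Type*} (W : Finset (Finset E)) (z : E → ℝ) : AugLink W → ℝ :=
  Sum.elim z (Sum.elim z (fun t => z t.2.1))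

/-- Key rates of the nodes of the augmented network: the added nodes inject no keys. -/
def augKeyRate {V E : Type*} (W : Finset (Finset E)) (Rw : V → ℝ) : AugNode V W → ℝ :=
  Sum.elim Rw (fun _ => 0)

/-- Feasibility for the linear program of the strategy, with message rate `Rs`, key rates `Rw`,
link transmission rates `z`, a flow `fA A` for each wiretap set `A`, and a flow `fd` to the
sink `d`; `c` gives the link capacities. -/
structure Feasible {V E : Type*} [Fintype V] [Fintype E] [DecidableEq V] [DecidableEq E]
    (G : Network V E) (W : Finset (Finset E)) (c : E → ℝ) (s d : V)
    (Rs : ℝ) (Rw : V → ℝ) (z : E → ℝ)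
    (fA : {A // A ∈ W} → AugLink W → ℝ) (fd : E → ℝ) : Prop where
  Rs_nonneg : 0 ≤ Rs
  Rw_nonneg : ∀ v, 0 ≤ Rw v
  z_nonneg : ∀ e, 0 ≤ z e
  fA_nonneg : ∀ A l, 0 ≤ fA A l
  fd_nonneg : ∀ e, 0 ≤ fd e
  wiretap_sink : ∀ A, (G.augment W).netOut (fA A) (virtualSink V A) = -∑ e ∈ A.1, z e
  wiretap_other : ∀ A i, i ≠ virtualSink V A →
    (G.augment W).netOut (fA A) i ≤ augKeyRate W Rw i
  sink : G.netOut fd d = -(Rs + ∑ v with v ≠ d, Rw v)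
  source : G.netOut fd s = Rs + Rw s
  other : ∀ i, i ≠ d → i ≠ s → G.netOut fd i = Rw i
  fA_le : ∀ A l, fA A l ≤ augCap W z l
  fd_le : ∀ e, fd e ≤ z e
  z_le : ∀ e, z e ≤ c e

/-! ### Network codes with keys injected at the nodes -/

/-- A network code with message alphabet `M`, key alphabet `K v` at the node `v`, and symbol
alphabet `X e` on the link `e`. The symbol on `e` is a function of the message (available only
if `e` leaves the source `s`), of the key of the node `tail e`, and of the symbols that this node
receives. The sink `d` estimates the message and the keys of all other nodes from what it
receives. In an acyclic network `signal` is determined by `enc` through `signal_eq`. -/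
structure NetworkCode {V E : Type*} (G : Network V E) (s d : V)
    (M : Type*) (K : V → Type*) (X : E → Type*) where
  enc : ∀ e, ((PLift (G.tail e = s) → M) × K (G.tail e) ×
    (∀ a : {a // G.head a = G.tail e}, X a.1)) → X e
  signal : M → (∀ v, K v) → ∀ e, X e
  signal_eq : ∀ m k e,
    signal m k e = enc e (fun _ => m, k (G.tail e), fun a => signal m k a.1)
  dec : (∀ a : {a // G.head a = d}, X a.1) → M × (∀ v : {v // v ≠ d}, K v.1)

/-- All encoding maps and the decoding map are linear over `F`. -/
def NetworkCode.IsLinear (F : Type*) [Field F] {V E : Type*} {G : Network V E} {s d : V}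
    {M : Type*} {K : V → Type*} {X : E → Type*}
    [AddCommGroup M] [Module F M] [∀ v, AddCommGroup (K v)] [∀ v, Module F (K v)]
    [∀ e, AddCommGroup (X e)] [∀ e, Module F (X e)] (C : NetworkCode G s d M K X) : Prop :=
  (∀ e, IsLinearMap F (C.enc e)) ∧ IsLinearMap F C.dec

/-- The sink recovers, without error, the message and the keys of all other nodes. -/
def NetworkCode.SinkDecodes {V E : Type*} {G : Network V E} {s d : V}
    {M : Type*} {K : V → Type*} {X : E → Type*} (C : NetworkCode G s d M K X) : Prop :=
  ∀ m k, C.dec (fun a => C.signal m k a.1) = (m, fun v : {v // v ≠ d} => k v.1)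

/-! ### Mutual information and secrecy -/

open Classical in
/-- Probability of the event `S` when the outcome `ω` has probability `P ω`. -/
noncomputable def prob {Ω : Type*} [Fintype Ω] (P : Ω → ℝ) (S : Ω → Prop) : ℝ :=
  ∑ ω with S ω, P ω

/-- Mutual information, in bits, of two random variables on a finite probability space. -/
noncomputable def mutualInfo {Ω α β : Type*} [Fintype Ω] [Fintype α] [Fintype β]
    (P : Ω → ℝ) (Y : Ω → α) (Z : Ω → β) : ℝ :=
  ∑ a, ∑ b, prob P (fun ω => Y ω = a ∧ Z ω = b) *
    Real.logb 2 (prob P (fun ω => Y ω = a ∧ Z ω = b) /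
      (prob P (fun ω => Y ω = a) * prob P (fun ω => Z ω = b)))

/-- Joint law of message and keys: the message has law `p`, the keys of the nodes are uniform,
and all these are independent. -/
noncomputable def jointLaw {V : Type*} {M : Type*} {K : V → Type*} [Fintype (∀ v, K v)]
    (p : M → ℝ) : M × (∀ v, K v) → ℝ :=
  fun ω => p ω.1 * (Fintype.card (∀ v, K v) : ℝ)⁻¹

/-- Perfect secrecy against a wiretapper of the set `A` of links: whatever the law of the message,
the message has zero mutual information with the symbols on the links of `A`. -/
def NetworkCode.PerfectlySecret {V E : Type*} [Fintype V] [DecidableEq V] [DecidableEq E]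
    {G : Network V E} {s d : V} {M : Type*} {K : V → Type*} {X : E → Type*}
    [Fintype M] [∀ v, Fintype (K v)] [∀ e, Fintype (X e)]
    (C : NetworkCode G s d M K X) (A : Finset E) : Prop :=
  ∀ p ∈ stdSimplex ℝ M,
    mutualInfo (jointLaw (K := K) p) (fun ω => ω.1)
      (fun ω => (fun e => C.signal ω.1 ω.2 e.1 : ∀ e : {e // e ∈ A}, X e.1)) = 0

end SecureNetwork

namespace SecureNetwork

/-! Split a link of integral rate `z e` into `z e` unit links. Each unit link imposes one
homogeneous linear equation between its own symbol and the data available at its tail. Both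
requirements become rank conditions on the coefficients. Secrecy: for every message some key makes
all symbols on `A` vanish, which holds if the equations of the unit links together with "the symbols
on `A` are zero" have independent rows in the link and key variables. Translation by such a key
changes the message without changing the observation (`masks_of_exists_key`), so the observation is
independent of the message. Decoding: the columns of the data not available at `d` are independent,
so combinations of the equations isolate each of these data.

A generic matrix with a prescribed support has such a rank as soon as an injection selects a
transversal inside the support: at a 0/1 point the selected minor is `1`. By `exists_common_nonzero`
all these minors are non-zero simultaneously over every large finite field. The injections come from
Hall's theorem applied to fractional matchings, and the flows supply these: an equation spreads the
flow through its link over the data at the tail and keeps the rest on its own symbol. Hence the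
flows themselves need not be integral.

For real rates, a `ℚ`-linear map from `ℝ` to `ℚ` close to the identity on the finitely many numbers
of the linear program preserves its equations exactly and, applied to the slacks, its inequalities.
Clearing denominators gives an integral point, coded over a field with `2 ^ (n / N)` elements. -/

/-! ### Fractional matchings and transport plans -/

/-- A fractional matching that saturates `I` can be rounded to an injection along its support. -/
theorem exists_injective_of_fractional_matching {I J : Type*} [Fintype I] [Fintype J]
    (p : I → J → ℝ) (p_nonneg : ∀ i j, 0 ≤ p i j) (row : ∀ i, 1 ≤ ∑ j, p i j)
    (col : ∀ j, ∑ i, p i j ≤ 1) :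
    ∃ σ : I → J, Function.Injective σ ∧ ∀ i, 0 < p i (σ i) := by
  classical
  let t : I → Finset J := fun i => Finset.univ.filter fun j => 0 < p i j
  -- Hall's condition by double counting: the rows in `S` have mass at least `|S|`, all of it in the
  -- columns `S.biUnion t`, each of which holds at most `1`.
  have hall : ∀ S : Finset I, S.card ≤ (S.biUnion t).card := by
    intro S
    have h1 : (S.card : ℝ) ≤ ∑ i ∈ S, ∑ j ∈ S.biUnion t, p i j := by
      rw [Finset.card_eq_sum_ones, Nat.cast_sum, Nat.cast_one]
      refine Finset.sum_le_sum fun i hi => (row i).trans (le_of_eq ?_)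
      symm
      refine Finset.sum_subset (Finset.subset_univ _) fun j _ hj => ?_
      by_contra hne
      exact hj (Finset.mem_biUnion.2 ⟨i, hi, Finset.mem_filter.2
        ⟨Finset.mem_univ _, lt_of_le_of_ne (p_nonneg i j) (Ne.symm hne)⟩⟩)
    have h2 : ∑ i ∈ S, ∑ j ∈ S.biUnion t, p i j ≤ ((S.biUnion t).card : ℝ) := by
      rw [Finset.sum_comm, Finset.card_eq_sum_ones, Nat.cast_sum, Nat.cast_one]
      refine Finset.sum_le_sum fun j _ => le_trans ?_ (col j)
      exact Finset.sum_le_sum_of_subset_of_nonneg (Finset.subset_univ _)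
        fun i _ _ => p_nonneg i j
    exact_mod_cast h1.trans h2
  obtain ⟨σ, hσ, hmem⟩ := (Finset.all_card_le_biUnion_card_iff_exists_injective t).1 hall
  exact ⟨σ, hσ, fun i => (Finset.mem_filter.1 (hmem i)).2⟩

/-- If at each node the demand does not exceed the supply, then there is a transport plan that
serves the whole demand locally. -/
theorem exists_local_transport {V I J : Type*} [Fintype I] [Fintype J] [DecidableEq V]
    (a : I → V) (b : J → V) (h : I → ℝ) (g : J → ℝ) (h_nonneg : ∀ i, 0 ≤ h i)
    (g_nonneg : ∀ j, 0 ≤ g j) (le : ∀ v, ∑ i with a i = v, h i ≤ ∑ j with b j = v, g j) :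
    ∃ p : I → J → ℝ, (∀ i j, 0 ≤ p i j) ∧ (∀ i j, 0 < p i j → b j = a i) ∧
      (∀ i, ∑ j, p i j = h i) ∧ ∀ j, ∑ i, p i j ≤ g j := by
  let T : V → ℝ := fun v => ∑ j with b j = v, g j
  have hT : ∀ v, 0 ≤ T v := fun v => Finset.sum_nonneg fun j _ => g_nonneg j
  -- Each demand is shared in proportion to the supplies at its node. Where the total supply is `0`
  -- the demand is `0` too, so division by zero is harmless.
  refine ⟨fun i j => if b j = a i then h i * g j / T (a i) else 0, ?_, ?_, ?_, ?_⟩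
  · intro i j
    have h1 := h_nonneg i
    have h2 := g_nonneg j
    have h3 := hT (a i)
    dsimp only
    split_ifs <;> positivity
  · intro i j hp
    by_contra hne
    simp [hne] at hp
  · intro i
    rw [← Finset.sum_filter, ← Finset.sum_div, ← Finset.mul_sum]
    change h i * T (a i) / T (a i) = h i
    rcases eq_or_ne (T (a i)) 0 with h0 | h0
    · have h1 : h i ≤ ∑ i' with a i' = a i, h i' :=
        Finset.single_le_sum (f := h) (fun i' _ => h_nonneg i') (by simp)
      have h2 : h i = 0 := le_antisymm (h1.trans ((le (a i)).trans h0.le)) (h_nonneg i)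
      simp [h2]
    · field_simp
  · intro j
    have h1 : ∀ i, (if b j = a i then h i * g j / T (a i) else 0) =
        if a i = b j then h i * (g j / T (b j)) else 0 := by
      intro i
      by_cases hij : a i = b j
      · simp [hij, mul_div_assoc]
      · simp [hij, Ne.symm hij]
    simp_rw [h1]
    rw [← Finset.sum_filter, ← Finset.sum_mul]
    have h2 : ∑ i with a i = b j, h i ≤ T (b j) := le (b j)
    calc (∑ i with a i = b j, h i) * (g j / T (b j)) ≤ T (b j) * (g j / T (b j)) :=
          mul_le_mul_of_nonneg_right h2 (div_nonneg (g_nonneg j) (hT _))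
      _ ≤ g j := by
          rcases eq_or_ne (T (b j)) 0 with h0 | h0
          · simpa [h0] using g_nonneg j
          · exact le_of_eq (by field_simp)

/-! ### Generic determinants -/

open MvPolynomial in
/-- Finitely many integer polynomials, each of which takes the value `1` somewhere, have a common
non-zero over each sufficiently large finite field. -/
theorem exists_common_nonzero {P T : Type*} [Fintype P] [Fintype T] (p : T → MvPolynomial P ℤ)
    (hp : ∀ t, ∃ θ : P → ℤ, aeval θ (p t) = 1) :
    ∃ q₀ : ℕ, ∀ (F : Type*) [Field F] [Fintype F], q₀ ≤ Fintype.card F →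
      ∃ θ : P → F, ∀ t, aeval θ (p t) ≠ 0 := by
  classical
  refine ⟨(∏ t, p t).totalDegree + 1, fun F _ _ hF => ?_⟩
  let r : MvPolynomial P F := map (Int.castRingHom F) (∏ t, p t)
  -- The value `1`, unlike an arbitrary non-zero integer, survives reduction to any characteristic;
  -- so one bound `q₀` serves all fields.
  have hr : r ≠ 0 := by
    simp only [r, map_prod]
    refine Finset.prod_ne_zero_iff.2 fun t _ h0 => ?_
    obtain ⟨θ, hθ⟩ := hp t
    have h1 := congrArg (Int.castRingHom F) hθ
    rw [map_one, aeval_def, eval₂_comp_left] at h1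
    have h2 := congrArg (eval (Int.castRingHom F ∘ θ)) h0
    rw [eval_map, map_zero] at h2
    have h3 : (Int.castRingHom F).comp (algebraMap ℤ ℤ) = Int.castRingHom F :=
      RingHom.ext_int _ _
    rw [h3, h2] at h1
    exact zero_ne_one h1
  have hdeg : ∀ i, r.degreeOf i < (Finset.univ : Finset F).card := by
    intro i
    have h1 : r.degreeOf i ≤ r.totalDegree := degreeOf_le_totalDegree r i
    have h2 : r.totalDegree ≤ (∏ t, p t).totalDegree := by
      simp only [r, totalDegree]
      exact Finset.sup_mono (support_map_subset _ _)
    rw [Finset.card_univ]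
    omega
  have h : ∃ θ : P → F, eval θ r ≠ 0 := by
    by_contra! hall
    exact hr (eq_zero_of_eval_zero_at_prod_finset r (fun _ => Finset.univ) hdeg
      fun x _ => hall x)
  obtain ⟨θ, hθ⟩ := h
  refine ⟨θ, fun t h0 => hθ ?_⟩
  have h4 : eval θ r = aeval θ (∏ t, p t) := by
    simp only [r, eval_map, aeval_def]
    rfl
  rw [h4, map_prod]
  exact Finset.prod_eq_zero (Finset.mem_univ t) h0

open MvPolynomial in
/-- If `N i j` are integer polynomials and `σ` selects a square submatrix with non-zero
determinant at `θ`, then the linear system with matrix `N` at `θ` is always solvable. -/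
theorem exists_solution_of_det_ne_zero {P I J F : Type*} [Fintype I] [DecidableEq I] [Fintype J]
    [Field F] (N : Matrix I J (MvPolynomial P ℤ)) (σ : I → J)
    (θ : P → F)
    (hdet : aeval θ (N.submatrix id σ).det ≠ 0) (rhs : I → F) :
    ∃ y : J → F, ∀ i, ∑ j, aeval θ (N i j) * y j = rhs i := by
  classical
  let B : Matrix I I F := (N.submatrix id σ).map (aeval θ)
  have hB : IsUnit B.det := by
    rw [isUnit_iff_ne_zero]
    rwa [AlgHom.map_det] at hdet
  let w : I → F := B⁻¹.mulVec rhs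
  have hw : B.mulVec w = rhs := by
    simp only [w, Matrix.mulVec_mulVec, Matrix.mul_nonsing_inv B hB, Matrix.one_mulVec]
  -- The solution of the square system is placed on the selected columns, with `0` on all others.
  refine ⟨fun j => ∑ i with σ i = j, w i, fun i => ?_⟩
  rw [← congrFun hw i]
  simp only [Matrix.mulVec, dotProduct, Finset.mul_sum, Finset.sum_filter]
  rw [Finset.sum_comm]
  refine Finset.sum_congr rfl fun i' _ => ?_
  simp [B]

open MvPolynomial in
/-- The submatrix selected by `σ` has determinant `1` where it specializes to the identity. -/
theorem aeval_det_submatrix_eq_one {P I J : Type*} [Fintype I] [DecidableEq I]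
    (N : Matrix I J (MvPolynomial P ℤ)) (σ : I → J) (θ : P → ℤ)
    (h : ∀ i i', aeval θ (N i (σ i')) = if i = i' then 1 else 0) :
    aeval θ (N.submatrix id σ).det = 1 := by
  rw [AlgHom.map_det]
  have : (aeval θ).mapMatrix (N.submatrix id σ) = (1 : Matrix I I ℤ) := by
    ext i i'
    simpa [Matrix.one_apply] using h i i'
  rw [this, Matrix.det_one]

/-! ### From flows to matchings and generic coefficients -/

/-- The node at which a unit of data is available: the head of a unit link, the node that injects
a key symbol, the source for a message symbol. -/
def unitNode {V L κ : Type*} (M : Type*) (hd : L → V) (nk : κ → V) (s : V) : (L ⊕ κ) ⊕ M → V :=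
  Sum.elim (Sum.elim hd nk) fun _ => s

/-- The data that may occur in the linear equation of the unit link `l`. -/
def Allowed {V L κ M : Type*} (tl hd : L → V) (nk : κ → V) (s : V) (l : L)
    (u : (L ⊕ κ) ⊕ M) : Prop :=
  u = Sum.inl (Sum.inl l) ∨ unitNode M hd nk s u = tl l

section Matching

variable {V L κ M : Type*} [Fintype L] [Fintype κ] [DecidableEq V]

/-- A fractional flow of the keys to the links of `A` yields a matching of the equations. -/
theorem exists_secrecy_matching (tl hd : L → V) (nk : κ → V) (s : V) (A : Finset L)
    (h₁ h₂ : L → ℝ) (h₂_nonneg : ∀ l, 0 ≤ h₂ l) (h₁_le : ∀ l, h₁ l ≤ 1)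
    (le : ∀ l, h₂ l ≤ h₁ l) (le_of_mem : ∀ l ∈ A, h₂ l + 1 ≤ h₁ l)
    (conserve : ∀ v, ∑ l with tl l = v, h₁ l ≤
      ∑ l with hd l = v, h₂ l + ∑ k with nk k = v, (1 : ℝ)) :
    ∃ σ : L ⊕ {l // l ∈ A} → L ⊕ κ, Function.Injective σ ∧
      (∀ l, Allowed (M := M) tl hd nk s l (Sum.inl (σ (Sum.inl l)))) ∧
      ∀ a, σ (Sum.inr a) = Sum.inl a.1 := by
  classical
  obtain ⟨p, p0, pn, pr, pc⟩ := exists_local_transport tl (Sum.elim hd nk) h₁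
    (Sum.elim h₂ fun _ => (1 : ℝ)) (fun l => (h₂_nonneg l).trans (le l))
    (by rintro (l | k); exacts [h₂_nonneg l, zero_le_one])
    (by
      intro v
      have h1 := conserve v
      simp only [Finset.sum_filter] at h1
      rw [Finset.sum_filter, Finset.sum_filter, Fintype.sum_sum_type]
      exact h1)
  -- The row of `l` keeps what `h₁ l` lacks to `1` on its own variable; the row of `a ∈ A` lies
  -- wholly on the variable `a`. Column `l` thus holds at most `h₂ l + 1 - h₁ l`, plus `1` if `l ∈
  -- A`, which is at most `1` by `le` and `le_of_mem`.
  let P : L ⊕ {l // l ∈ A} → L ⊕ κ → ℝ := Sum.elim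
    (fun l j => p l j + if j = Sum.inl l then 1 - h₁ l else 0)
    (fun a j => if j = Sum.inl a.1 then 1 else 0)
  obtain ⟨σ, hσ, hpos⟩ := exists_injective_of_fractional_matching P
    (by
      rintro (l | a) j
      · have := p0 l j
        have := h₁_le l
        simp only [P, Sum.elim_inl]
        split_ifs <;> linarith
      · simp only [P, Sum.elim_inr]
        split_ifs <;> norm_num)
    (by
      rintro (l | a)
      · simp only [P, Sum.elim_inl, Finset.sum_add_distrib, pr]
        simp
      · simp [P])
    (by
      rintro (l | k)
      · have h1 := pc (Sum.inl l)
        have h2 : ∑ a : {l // l ∈ A}, (if l = a.1 then (1 : ℝ) else 0) =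
            if l ∈ A then 1 else 0 := by
          rw [Finset.sum_coe_sort A fun x => if l = x then (1 : ℝ) else 0, Finset.sum_ite_eq]
        simp only [Sum.elim_inl] at h1
        simp only [P, Fintype.sum_sum_type, Sum.elim_inl, Sum.elim_inr, Sum.inl.injEq,
          Finset.sum_add_distrib, h2, Finset.sum_ite_eq, Finset.mem_univ, if_true]
        split_ifs with hl
        · have := le_of_mem l hl
          linarith
        · have := le l
          linarith
      · have h1 := pc (Sum.inr k)
        simpa [P] using h1)
  refine ⟨σ, hσ, fun l => ?_, fun a => ?_⟩
  · have h := hpos (Sum.inl l)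
    by_cases hl : σ (Sum.inl l) = Sum.inl l
    · exact Or.inl (by rw [hl])
    · simp only [P, Sum.elim_inl, hl, if_false, add_zero] at h
      exact Or.inr (pn _ _ h)
  · have h := hpos (Sum.inr a)
    by_contra hl
    simp [P, hl] at h

/-- A fractional flow of all data to the sink `d` yields a matching of the data not available at
`d` into the equations. -/
theorem exists_decoding_matching [Fintype M] (tl hd : L → V) (nk : κ → V) (s d : V)
    (h : L → ℝ) (h_nonneg : ∀ l, 0 ≤ h l) (h_le : ∀ l, h l ≤ 1)
    (conserve : ∀ v, v ≠ d → ∑ l with hd l = v, h l + ∑ k with nk k = v, (1 : ℝ) +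
      (∑ _m : M, if s = v then 1 else 0) ≤ ∑ l with tl l = v, h l) :
    ∃ σ : {u : (L ⊕ κ) ⊕ M // unitNode M hd nk s u ≠ d} → L, Function.Injective σ ∧
      ∀ u, Allowed tl hd nk s (σ u) u.1 := by
  classical
  let g : (L ⊕ κ) ⊕ M → ℝ := Sum.elim (Sum.elim h fun _ => 1) fun _ => 1
  have hg : ∀ u, 0 ≤ g u := by
    rintro ((l | k) | m)
    exacts [h_nonneg l, zero_le_one, zero_le_one]
  -- The roles are reversed compared with secrecy: data are the demands, and the links leaving a
  -- node are the supplies.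
  obtain ⟨p, p0, pn, pr, pc⟩ := exists_local_transport
    (fun u : {u : (L ⊕ κ) ⊕ M // unitNode M hd nk s u ≠ d} => unitNode M hd nk s u.1) tl
    (fun u => g u.1) h (fun u => hg u.1) h_nonneg
    (by
      intro v
      by_cases hv : v = d
      · subst hv
        rw [Finset.filter_false_of_mem fun u _ => u.2, Finset.sum_empty]
        exact Finset.sum_nonneg fun l _ => h_nonneg l
      · refine le_trans (le_of_eq ?_) (conserve v hv)
        have h1 : ∑ u : {u : (L ⊕ κ) ⊕ M // unitNode M hd nk s u ≠ d} with
            unitNode M hd nk s u.1 = v, g u.1 = ∑ u with unitNode M hd nk s u = v, g u := by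
          refine Finset.sum_bij_ne_zero (fun u _ _ => u.1)
            (fun u hu _ => by simpa using hu) (fun _ _ _ _ _ _ h => Subtype.ext h)
            (fun u hu h0 => ?_) (fun _ _ _ => rfl)
          have h2 : unitNode M hd nk s u = v := by simpa using hu
          exact ⟨⟨u, by rwa [h2]⟩, by simpa using h2, h0, rfl⟩
        rw [h1, Finset.sum_filter, Fintype.sum_sum_type, Fintype.sum_sum_type, Finset.sum_filter,
          Finset.sum_filter]
        rfl)
  let P : {u : (L ⊕ κ) ⊕ M // unitNode M hd nk s u ≠ d} → L → ℝ := fun u l =>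
    p u l + if u.1 = Sum.inl (Sum.inl l) then 1 - h l else 0
  obtain ⟨σ, hσ, hpos⟩ := exists_injective_of_fractional_matching P
    (by
      intro u l
      have := p0 u l
      have := h_le l
      simp only [P]
      split_ifs <;> linarith)
    (by
      rintro ⟨(l | k) | m, hu⟩
      · simp [P, Finset.sum_add_distrib, pr, g]
      · simp [P, pr, g]
      · simp [P, pr, g])
    (by
      intro l
      have h1 := pc l
      have h2 : ∑ u : {u : (L ⊕ κ) ⊕ M // unitNode M hd nk s u ≠ d},
          (if u.1 = Sum.inl (Sum.inl l) then 1 - h l else 0) ≤ 1 - h l := by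
        have h3 := h_le l
        by_cases hl : hd l = d
        · rw [Finset.sum_eq_zero]
          · linarith
          · intro u _
            rw [if_neg]
            intro hu
            exact u.2 (by rw [hu]; exact hl)
        · rw [Finset.sum_eq_single (⟨Sum.inl (Sum.inl l), hl⟩ :
            {u : (L ⊕ κ) ⊕ M // unitNode M hd nk s u ≠ d})]
          · simp
          · intro u _ hu
            rw [if_neg]
            intro h4
            exact hu (Subtype.ext h4)
          · simp
      simp only [P, Finset.sum_add_distrib]
      linarith)
  refine ⟨σ, hσ, fun u => ?_⟩
  have h1 := hpos u
  by_cases hl : u.1 = Sum.inl (Sum.inl (σ u))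
  · exact Or.inl hl
  · simp only [P, hl, if_false, add_zero] at h1
    exact Or.inr (pn _ _ h1).symm

open MvPolynomial in
/-- Over each sufficiently large finite field there are coefficients for the linear equations of
the unit links that make all the square systems selected by the matchings regular. -/
theorem exists_generic_coefficients [Fintype M] {T : Type*} [Fintype T] (tl hd : L → V)
    (nk : κ → V) (s d : V) (A : T → Finset L)
    (hsec : ∀ t, ∃ σ : L ⊕ {l // l ∈ A t} → L ⊕ κ, Function.Injective σ ∧
      (∀ l, Allowed (M := M) tl hd nk s l (Sum.inl (σ (Sum.inl l)))) ∧
      ∀ a, σ (Sum.inr a) = Sum.inl a.1)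
    (hdec : ∃ σ : {u : (L ⊕ κ) ⊕ M // unitNode M hd nk s u ≠ d} → L, Function.Injective σ ∧
      ∀ u, Allowed tl hd nk s (σ u) u.1) :
    ∃ q₀ : ℕ, ∀ (F : Type*) [Field F] [Fintype F], q₀ ≤ Fintype.card F →
      ∃ θ : L → (L ⊕ κ) ⊕ M → F,
        (∀ l u, ¬ Allowed tl hd nk s l u → θ l u = 0) ∧
        (∀ l, θ l (Sum.inl (Sum.inl l)) ≠ 0) ∧
        (∀ t, ∀ rhs : L → F, ∃ y : L ⊕ κ → F,
          (∀ l, ∑ j, θ l (Sum.inl j) * y j = rhs l) ∧ ∀ l ∈ A t, y (Sum.inl l) = 0) ∧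
        ∀ u₀, unitNode M hd nk s u₀ ≠ d → ∃ D : L → F,
          ∑ l, D l * θ l u₀ = 1 ∧
            ∀ u, unitNode M hd nk s u ≠ d → u ≠ u₀ → ∑ l, D l * θ l u = 0 := by
  classical
  choose σ hσ hσA hσv using hsec
  obtain ⟨τ, hτ, hτA⟩ := hdec
  let X' : L → (L ⊕ κ) ⊕ M → MvPolynomial (L × ((L ⊕ κ) ⊕ M)) ℤ := fun l u =>
    if Allowed tl hd nk s l u then X (l, u) else 0
  let N : ∀ t, Matrix (L ⊕ {l // l ∈ A t}) (L ⊕ κ) (MvPolynomial (L × ((L ⊕ κ) ⊕ M)) ℤ) :=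
    fun t => Sum.elim (fun l j => X' l (Sum.inl j)) fun a j => if j = Sum.inl a.1 then 1 else 0
  let N' : Matrix {u : (L ⊕ κ) ⊕ M // unitNode M hd nk s u ≠ d} L
      (MvPolynomial (L × ((L ⊕ κ) ⊕ M)) ℤ) := fun u l => X' l u.1
  -- Three kinds of non-vanishing: the secrecy minors, the diagonal coefficients (each equation must
  -- be solvable for its own symbol), and the decoding minor.
  let poly : T ⊕ L ⊕ Unit → MvPolynomial (L × ((L ⊕ κ) ⊕ M)) ℤ :=
    Sum.elim (fun t => ((N t).submatrix id (σ t)).det)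
      (Sum.elim (fun l => X (l, Sum.inl (Sum.inl l))) fun _ => (N'.submatrix id τ).det)
  obtain ⟨q₀, hq⟩ := exists_common_nonzero poly (by
    rintro (t | l | _)
    -- Setting exactly the matched coefficients to `1` turns the selected minor into the identity,
    -- since `σ t` is injective.
    · refine ⟨fun x => if x.2 = Sum.inl (σ t (Sum.inl x.1)) then 1 else 0,
        aeval_det_submatrix_eq_one _ _ _ ?_⟩
      rintro (l | a) i'
      · by_cases hi : Sum.inl l = i'
        · subst hi
          simp [N, X', hσA]
        · have : σ t i' ≠ σ t (Sum.inl l) := fun h => hi (hσ t h).symm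
          by_cases hA : Allowed (M := M) tl hd nk s l (Sum.inl (σ t i'))
          · simp [N, X', hA, this, hi]
          · simp [N, X', hA, hi]
      · have : (σ t i' = Sum.inl a.1) ↔ Sum.inr a = i' := by
          rw [← hσv t a]
          exact ⟨fun h => (hσ t h).symm, fun h => by rw [h]⟩
        by_cases hi : Sum.inr a = i'
        · subst hi
          simp [N, hσv]
        · simp [N, this, hi]
    · exact ⟨fun _ => 1, by simp [poly]⟩
    · refine ⟨fun x => if ∃ h, x.1 = τ ⟨x.2, h⟩ then 1 else 0,
        aeval_det_submatrix_eq_one _ _ _ ?_⟩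
      intro u u'
      by_cases hu : u = u'
      · subst hu
        have h1 := u.2
        simp [N', X', hτA, h1]
      · have : ¬ ∃ h, τ u' = τ ⟨u.1, h⟩ := fun ⟨_, h⟩ => hu (hτ h).symm
        by_cases hA : Allowed (M := M) tl hd nk s (τ u') u.1
        · simp only [N', X', hA, if_true, aeval_X, this, if_false, hu]
        · simp [N', X', hA, hu])
  refine ⟨q₀, fun F _ _ hF => ?_⟩
  obtain ⟨θ, hθ⟩ := hq F hF
  have hX : ∀ l u, aeval θ (X' l u) = if Allowed tl hd nk s l u then θ (l, u) else 0 := by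
    intro l u
    simp only [X']
    split_ifs <;> simp
  refine ⟨fun l u => if Allowed tl hd nk s l u then θ (l, u) else 0, ?_, ?_, ?_, ?_⟩
  · intro l u h
    exact if_neg h
  · intro l
    have h1 := hθ (Sum.inr (Sum.inl l))
    have h2 : Allowed tl hd nk s l (Sum.inl (Sum.inl l) : (L ⊕ κ) ⊕ M) := Or.inl rfl
    simpa [poly, h2] using h1
  · intro t rhs
    obtain ⟨y, hy⟩ := exists_solution_of_det_ne_zero (N t) (σ t) θ (hθ (Sum.inl t))
      (Sum.elim rhs fun _ => 0)
    refine ⟨y, fun l => ?_, fun l hl => ?_⟩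
    · simpa only [N, Sum.elim_inl, hX] using hy (Sum.inl l)
    · simpa [N, apply_ite] using hy (Sum.inr ⟨l, hl⟩)
  · intro u₀ hu₀
    obtain ⟨D, hD⟩ := exists_solution_of_det_ne_zero N' τ θ (hθ (Sum.inr (Sum.inr ())))
      (fun u => if u.1 = u₀ then 1 else 0)
    have hD' : ∀ u, unitNode M hd nk s u ≠ d → ∑ l, D l *
        (if Allowed tl hd nk s l u then θ (l, u) else 0) = if u = u₀ then 1 else 0 := by
      intro u hu
      rw [← hD ⟨u, hu⟩]
      simp only [N', hX, mul_comm]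
    exact ⟨D, (hD' u₀ hu₀).trans (if_pos rfl),
      fun u hu hne => (hD' u hu).trans (if_neg hne)⟩

end Matching

theorem sum_sigma_ite {E R : Type*} [Fintype E] [AddCommMonoid R] {z : E → ℕ} (p : E → Prop)
    [DecidablePred p] (f : (Σ e, Fin (z e)) → R) :
    ∑ l, (if p l.1 then f l else 0) = ∑ a : {a // p a}, ∑ j, f ⟨a.1, j⟩ := by
  rw [Fintype.sum_sigma, ← Finset.sum_subtype (Finset.univ.filter p) (by simp)
    fun e => ∑ j, f ⟨e, j⟩, Finset.sum_filter]
  refine Finset.sum_congr rfl fun e _ => ?_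
  split_ifs <;> simp

/-! ### Codes in acyclic networks and masking -/

section Codes

variable {V E : Type*} {G : Network V E} {s d : V} {M : Type*} {K : V → Type*} {X : E → Type*}

/-- A cycle of links projects under `G.tail` to a cycle of nodes, and an irreflexive transitive
relation on a finite type is well founded. This permits recursion along the links. -/
theorem Network.Acyclic.wellFounded [Finite E] (hG : G.Acyclic) :
    WellFounded fun a e => G.head a = G.tail e := by
  let r : E → E → Prop := fun a e => G.head a = G.tail e
  have hirr : Std.Irrefl (Relation.TransGen r) := ⟨fun e he =>
    hG (G.tail e) (Relation.TransGen.lift (r := r) G.tail (fun a b hab => ⟨a, rfl, hab⟩) e e he)⟩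
  have hwf : WellFounded (Relation.TransGen r) := Finite.wellFounded_of_trans_of_irrefl _
  exact Subrelation.wf (r := Relation.TransGen r) (fun h => Relation.TransGen.single h) hwf

/-- In an acyclic network each choice of encoding and decoding maps defines a code. -/
theorem exists_code [Finite E] (hG : G.Acyclic)
    (enc : ∀ e, ((PLift (G.tail e = s) → M) × K (G.tail e) ×
      (∀ a : {a // G.head a = G.tail e}, X a.1)) → X e)
    (dec : (∀ a : {a // G.head a = d}, X a.1) → M × (∀ v : {v // v ≠ d}, K v.1)) :
    ∃ C : NetworkCode G s d M K X, C.enc = enc ∧ C.dec = dec :=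
  ⟨{ enc := enc
     dec := dec
     signal := fun m k => hG.wellFounded.fix fun e ih =>
      enc e (fun _ => m, k (G.tail e), fun a => ih a.1 a.2)
     signal_eq := fun _ _ e => hG.wellFounded.fix_eq _ e }, rfl, rfl⟩

/-- Uniqueness of the symbols: it lets a solution of the linear system be recognized as an actual
transmission. -/
theorem NetworkCode.eq_signal [Finite E] (hG : G.Acyclic) (C : NetworkCode G s d M K X) (m : M)
    (k : ∀ v, K v) (x : ∀ e, X e)
    (hx : ∀ e, x e = C.enc e (fun _ => m, k (G.tail e), fun a => x a.1)) : x = C.signal m k := by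
  funext e
  induction e using hG.wellFounded.induction with
  | h e ih =>
    rw [hx, C.signal_eq]
    congr 3
    funext a
    exact ih a.1 a.2

/-- The key of a node does not influence the links that the node does not reach. -/
theorem NetworkCode.signal_congr [Finite E] (hG : G.Acyclic) (C : NetworkCode G s d M K X)
    (m : M) (k k' : ∀ v, K v) (w : V) (hk : ∀ v, v ≠ w → k v = k' v) (e : E)
    (he : ¬ Relation.ReflTransGen (fun u v => ∃ e, G.tail e = u ∧ G.head e = v) w (G.tail e)) :
    C.signal m k e = C.signal m k' e := by
  induction e using hG.wellFounded.induction with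
  | h e ih =>
    have h1 : k (G.tail e) = k' (G.tail e) :=
      hk _ fun h => he (h ▸ Relation.ReflTransGen.refl)
    have h2 : (fun a : {a // G.head a = G.tail e} => C.signal m k a.1) =
        fun a : {a // G.head a = G.tail e} => C.signal m k' a.1 :=
      funext fun a => ih a.1 a.2 fun h => he (h.tail ⟨a.1, rfl, a.2⟩)
    rw [C.signal_eq, C.signal_eq, h1, h2]

/-- An influence of the key of `d` on a link entering `d` would close a cycle through `d`. Hence the
decoder may assume this key to be `0`. -/
theorem NetworkCode.signal_congr_sink [Finite E] (hG : G.Acyclic) (C : NetworkCode G s d M K X)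
    (m : M) (k k' : ∀ v, K v) (hk : ∀ v, v ≠ d → k v = k' v) (e : E) (he : G.head e = d) :
    C.signal m k e = C.signal m k' e :=
  C.signal_congr hG m k k' d hk e fun h => hG d (Relation.TransGen.tail' h ⟨e, rfl, he⟩)

/-- For any two messages a permutation of the keys produces the same symbols on the links
of `A`. -/
def NetworkCode.Masks (C : NetworkCode G s d M K X) (A : Finset E) : Prop :=
  ∀ m m', ∃ π : Equiv.Perm (∀ v, K v), ∀ k, ∀ e ∈ A, C.signal m' (π k) e = C.signal m k e

theorem NetworkCode.signal_add [Finite E] (hG : G.Acyclic) [AddCommGroup M]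
    [∀ v, AddCommGroup (K v)] [∀ e, AddCommGroup (X e)] (C : NetworkCode G s d M K X)
    (hC : ∀ e x y, C.enc e (x + y) = C.enc e x + C.enc e y)
    (m m' : M) (k k' : ∀ v, K v) :
    C.signal (m + m') (k + k') = C.signal m k + C.signal m' k' := by
  symm
  refine C.eq_signal hG _ _ _ fun e => ?_
  rw [Pi.add_apply, C.signal_eq m k e, C.signal_eq m' k' e, ← hC]
  rfl

/-- By additivity, translating the keys by one that cancels `m' - m` on `A` is the required
permutation. -/
theorem NetworkCode.masks_of_exists_key [Finite E] (hG : G.Acyclic) [AddCommGroup M]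
    [∀ v, AddCommGroup (K v)] [∀ e, AddCommGroup (X e)] (C : NetworkCode G s d M K X)
    (hC : ∀ e x y, C.enc e (x + y) = C.enc e x + C.enc e y) (A : Finset E)
    (hA : ∀ m, ∃ k, ∀ e ∈ A, C.signal m k e = 0) : C.Masks A := by
  intro m m'
  obtain ⟨k₀, hk₀⟩ := hA (m' - m)
  refine ⟨Equiv.addRight k₀, fun k e he => ?_⟩
  have h := congrFun (C.signal_add hG hC m (m' - m) k k₀) e
  rw [add_sub_cancel, Pi.add_apply, hk₀ e he, add_zero] at h
  exact h

end Codes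

/-! ### Linear codes from regular coefficients -/

section LinearCodes

variable {V E : Type*} [Fintype V] [Fintype E] [DecidableEq V] [DecidableEq E]
  {Rs : ℕ} {Rw : V → ℕ} {z : E → ℕ} {F : Type*} [Field F]

/-- Values of all unit data. -/
def unitValue (x : ∀ e, Fin (z e) → F) (k : ∀ v, Fin (Rw v) → F) (m : Fin Rs → F) :
    ((Σ e, Fin (z e)) ⊕ (Σ v, Fin (Rw v))) ⊕ Fin Rs → F :=
  Sum.elim (Sum.elim (fun l => x l.1 l.2) fun j => k j.1 j.2) m

/-- The encoding map of the link `e` that solves the linear equations with coefficients `θ`. -/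
def linearEnc (G : Network V E) (s : V)
    (θ : (Σ e, Fin (z e)) → ((Σ e, Fin (z e)) ⊕ (Σ v, Fin (Rw v))) ⊕ Fin Rs → F) (e : E) :
    ((PLift (G.tail e = s) → Fin Rs → F) × (Fin (Rw (G.tail e)) → F) ×
      (∀ a : {a // G.head a = G.tail e}, Fin (z a.1) → F)) → Fin (z e) → F := fun t i =>
  -(θ ⟨e, i⟩ (Sum.inl (Sum.inl ⟨e, i⟩)))⁻¹ *
    (∑ a : {a // G.head a = G.tail e}, ∑ j, θ ⟨e, i⟩ (Sum.inl (Sum.inl ⟨a.1, j⟩)) * t.2.2 a j +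
      ∑ j, θ ⟨e, i⟩ (Sum.inl (Sum.inr ⟨G.tail e, j⟩)) * t.2.1 j +
      ∑ j, θ ⟨e, i⟩ (Sum.inr j) * if h : G.tail e = s then t.1 ⟨h⟩ j else 0)

omit [Fintype V] [DecidableEq E] in
theorem isLinearMap_linearEnc (G : Network V E) (s : V)
    (θ : (Σ e, Fin (z e)) → ((Σ e, Fin (z e)) ⊕ (Σ v, Fin (Rw v))) ⊕ Fin Rs → F) (e : E) :
    IsLinearMap F (linearEnc G s θ e) := by
  constructor
  · intro t t'
    funext i
    by_cases h : G.tail e = s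
    · simp only [linearEnc, h, Prod.fst_add, Prod.snd_add, Pi.add_apply, mul_add,
        Finset.sum_add_distrib, dite_true]
      ring
    · simp only [linearEnc, h, Prod.fst_add, Prod.snd_add, Pi.add_apply, mul_add,
        Finset.sum_add_distrib, dite_false, mul_zero, Finset.sum_const_zero]
      ring
  · intro c t
    funext i
    by_cases h : G.tail e = s
    · simp only [linearEnc, h, Prod.smul_fst, Prod.smul_snd, Pi.smul_apply, smul_eq_mul,
        dite_true, mul_left_comm _ c, ← Finset.mul_sum, ← mul_add]
    · simp only [linearEnc, h, Prod.smul_fst, Prod.smul_snd, Pi.smul_apply, smul_eq_mul,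
        dite_false, mul_left_comm _ c, ← Finset.mul_sum, ← mul_add, mul_zero,
        Finset.sum_const_zero, add_zero]

/-- The linear equations hold exactly if the symbols obey the encoding maps. -/
theorem eq_linearEnc_iff (G : Network V E) (hG : G.Acyclic) (s : V)
    (θ : (Σ e, Fin (z e)) → ((Σ e, Fin (z e)) ⊕ (Σ v, Fin (Rw v))) ⊕ Fin Rs → F)
    (hθ : ∀ l u, ¬ Allowed (fun l => G.tail l.1) (fun l => G.head l.1) (fun k => k.1) s l u →
      θ l u = 0) (hdiag : ∀ l, θ l (Sum.inl (Sum.inl l)) ≠ 0)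
    (x : ∀ e, Fin (z e) → F) (k : ∀ v, Fin (Rw v) → F) (m : Fin Rs → F) (e : E) (i : Fin (z e)) :
    x e i = linearEnc G s θ e (fun _ => m, k (G.tail e), fun a => x a.1) i ↔
      ∑ u, θ ⟨e, i⟩ u * unitValue x k m u = 0 := by
  -- Without loops the unit link is not among the data received by its own tail, so the splitting in
  -- `hL` counts it once.
  have hloop : ∀ e', G.head e' ≠ G.tail e' := fun e' h =>
    hG (G.tail e') (Relation.TransGen.single ⟨e', rfl, h⟩)
  have hL : ∑ l : Σ e, Fin (z e), θ ⟨e, i⟩ (Sum.inl (Sum.inl l)) * x l.1 l.2 =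
      θ ⟨e, i⟩ (Sum.inl (Sum.inl ⟨e, i⟩)) * x e i + ∑ a : {a // G.head a = G.tail e},
        ∑ j, θ ⟨e, i⟩ (Sum.inl (Sum.inl ⟨a.1, j⟩)) * x a.1 j := by
    have h1 : ∀ l : Σ e, Fin (z e), θ ⟨e, i⟩ (Sum.inl (Sum.inl l)) * x l.1 l.2 =
        (if l = ⟨e, i⟩ then θ ⟨e, i⟩ (Sum.inl (Sum.inl l)) * x l.1 l.2 else 0) +
        if G.head l.1 = G.tail e then θ ⟨e, i⟩ (Sum.inl (Sum.inl l)) * x l.1 l.2 else 0 := by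
      intro l
      by_cases hl : l = ⟨e, i⟩
      · have := hloop e
        simp [hl, this]
      · by_cases hn : G.head l.1 = G.tail e
        · simp [hl, hn]
        · rw [if_neg hl, if_neg hn, hθ, zero_mul, add_zero]
          rintro (h | h)
          · exact hl (by simpa using h)
          · exact hn h
    rw [Finset.sum_congr rfl fun l _ => h1 l, Finset.sum_add_distrib, Finset.sum_ite_eq' ]
    simp only [Finset.mem_univ, if_true]
    congr 1
    exact sum_sigma_ite (fun a => G.head a = G.tail e)
      fun l => θ ⟨e, i⟩ (Sum.inl (Sum.inl l)) * x l.1 l.2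
  have hK : ∑ j : Σ v, Fin (Rw v), θ ⟨e, i⟩ (Sum.inl (Sum.inr j)) * k j.1 j.2 =
      ∑ j, θ ⟨e, i⟩ (Sum.inl (Sum.inr ⟨G.tail e, j⟩)) * k (G.tail e) j := by
    rw [Fintype.sum_sigma, Fintype.sum_eq_single (G.tail e)]
    intro v hv
    refine Finset.sum_eq_zero fun j _ => ?_
    rw [hθ, zero_mul]
    rintro (h | h)
    · simp at h
    · exact hv h
  have hM : ∑ j, θ ⟨e, i⟩ (Sum.inr j) * m j =
      ∑ j, θ ⟨e, i⟩ (Sum.inr j) * if h : G.tail e = s then m j else 0 := by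
    refine Finset.sum_congr rfl fun j _ => ?_
    by_cases h : G.tail e = s
    · simp [h]
    · rw [hθ, zero_mul, zero_mul]
      rintro (h' | h')
      · simp at h'
      · exact h h'.symm
  rw [Fintype.sum_sum_type, Fintype.sum_sum_type]
  simp only [unitValue, Sum.elim_inl, Sum.elim_inr]
  rw [hL, hK, hM]
  simp only [linearEnc]
  have h0 := hdiag ⟨e, i⟩
  constructor
  · intro h
    rw [h]
    field_simp
    ring
  · intro h
    field_simp
    linear_combination h

/-- Coefficients with the regularity properties of `exists_generic_coefficients` define a linear
code that the sink decodes and whose symbols on the sets in `W` are masked by the keys. -/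
theorem exists_linear_code (G : Network V E) (hG : G.Acyclic) (s d : V) (hsd : s ≠ d)
    (W : Finset (Finset E))
    (θ : (Σ e, Fin (z e)) → ((Σ e, Fin (z e)) ⊕ (Σ v, Fin (Rw v))) ⊕ Fin Rs → F)
    (hθ : ∀ l u, ¬ Allowed (fun l => G.tail l.1) (fun l => G.head l.1) (fun k => k.1) s l u →
      θ l u = 0) (hdiag : ∀ l, θ l (Sum.inl (Sum.inl l)) ≠ 0)
    (hsec : ∀ A ∈ W, ∀ rhs : (Σ e, Fin (z e)) → F,
      ∃ y : (Σ e, Fin (z e)) ⊕ (Σ v, Fin (Rw v)) → F,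
        (∀ l, ∑ j, θ l (Sum.inl j) * y j = rhs l) ∧ ∀ l, l.1 ∈ A → y (Sum.inl l) = 0)
    (hdec : ∀ u₀, unitNode (Fin Rs) (fun l : Σ e, Fin (z e) => G.head l.1)
        (fun k : Σ v, Fin (Rw v) => k.1) s u₀ ≠ d →
      ∃ D : (Σ e, Fin (z e)) → F, ∑ l, D l * θ l u₀ = 1 ∧
        ∀ u, unitNode (Fin Rs) (fun l : Σ e, Fin (z e) => G.head l.1)
          (fun k : Σ v, Fin (Rw v) => k.1) s u ≠ d → u ≠ u₀ → ∑ l, D l * θ l u = 0) :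
    ∃ C : NetworkCode G s d (Fin Rs → F) (fun v => Fin (Rw v) → F) (fun e => Fin (z e) → F),
      C.IsLinear F ∧ C.SinkDecodes ∧ ∀ A ∈ W, C.Masks A := by
  choose! D hD₁ hD₀ using hdec
  -- `R r l` is the part of equation `l` that the sink can evaluate from the received symbols `r`.
  let R : (∀ a : {a // G.head a = d}, Fin (z a.1) → F) → (Σ e, Fin (z e)) → F := fun r l =>
    ∑ a : {a // G.head a = d}, ∑ j, θ l (Sum.inl (Sum.inl ⟨a.1, j⟩)) * r a j
  have hR_add : ∀ r r' l, R (r + r') l = R r l + R r' l := fun r r' l => by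
    simp only [R, Pi.add_apply, mul_add, Finset.sum_add_distrib]
  have hR_smul : ∀ (c : F) r l, R (c • r) l = c * R r l := fun c r l => by
    simp only [R, Pi.smul_apply, smul_eq_mul, mul_left_comm _ c, ← Finset.mul_sum]
  obtain ⟨C, hCenc, hCdec⟩ := exists_code (s := s) (d := d) (M := Fin Rs → F)
    (K := fun v => Fin (Rw v) → F) (X := fun e => Fin (z e) → F) hG (linearEnc G s θ) fun r =>
      (fun j => -∑ l, D (Sum.inr j) l * R r l,
        fun v j => -∑ l, D (Sum.inl (Sum.inr ⟨v.1, j⟩)) l * R r l)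
  have hsig : ∀ m k l, ∑ u, θ l u * unitValue (C.signal m k) k m u = 0 := by
    rintro m k ⟨e, i⟩
    rw [← eq_linearEnc_iff G hG s θ hθ hdiag]
    exact congrFun (hCenc ▸ C.signal_eq m k e) i
  have hadd : ∀ e x y, C.enc e (x + y) = C.enc e x + C.enc e y := by
    intro e x y
    rw [hCenc]
    exact (isLinearMap_linearEnc G s θ e).map_add x y
  refine ⟨C, ⟨fun e => hCenc ▸ isLinearMap_linearEnc G s θ e, ?_⟩, ?_, ?_⟩
  · rw [hCdec]
    constructor
    · intro r r'
      refine Prod.ext ?_ ?_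
      · funext j
        simp only [hR_add, mul_add, Finset.sum_add_distrib, Prod.fst_add, Pi.add_apply]
        ring
      · funext v j
        simp only [hR_add, mul_add, Finset.sum_add_distrib, Prod.snd_add, Pi.add_apply]
        ring
    · intro c r
      refine Prod.ext ?_ ?_
      · funext j
        simp only [hR_smul, mul_left_comm _ c, ← Finset.mul_sum, Prod.smul_fst, Pi.smul_apply,
          smul_eq_mul, mul_neg]
      · funext v j
        simp only [hR_smul, mul_left_comm _ c, ← Finset.mul_sum, Prod.smul_snd, Pi.smul_apply,
          smul_eq_mul, mul_neg]
  · intro m k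
    -- With the key of `d` replaced by `0`, and the message absent from `d` because `s ≠ d`, `R` is
    -- the whole contribution of the data available at `d`.
    let k' : ∀ v, Fin (Rw v) → F := fun v => if v = d then 0 else k v
    have hk' : ∀ v, v ≠ d → k v = k' v := fun v hv => by simp [k', hv]
    have hrec : (fun a : {a // G.head a = d} => C.signal m k a.1) =
        fun a : {a // G.head a = d} => C.signal m k' a.1 :=
      funext fun a => C.signal_congr_sink hG m k k' hk' a.1 a.2
    have key : ∀ u₀, unitNode (Fin Rs) (fun l : Σ e, Fin (z e) => G.head l.1)
        (fun k : Σ v, Fin (Rw v) => k.1) s u₀ ≠ d →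
        -∑ l, D u₀ l * R (fun a => C.signal m k' a.1) l = unitValue (C.signal m k') k' m u₀ := by
      intro u₀ hu₀
      have hRl : ∀ l, R (fun a => C.signal m k' a.1) l =
          ∑ u, if unitNode (Fin Rs) (fun l : Σ e, Fin (z e) => G.head l.1)
            (fun k : Σ v, Fin (Rw v) => k.1) s u = d
            then θ l u * unitValue (C.signal m k') k' m u else 0 := by
        intro l
        have h2 : ∑ j : Σ v, Fin (Rw v), (if j.1 = d then
            θ l (Sum.inl (Sum.inr j)) * k' j.1 j.2 else 0) = 0 := by
          refine Finset.sum_eq_zero fun j _ => ?_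
          split_ifs with h
          · simp [k', h]
          · rfl
        simp only [Fintype.sum_sum_type, unitNode, unitValue, Sum.elim_inl, Sum.elim_inr, hsd,
          if_false, Finset.sum_const_zero, add_zero, R]
        exact (add_zero _).symm.trans (congrArg₂ (· + ·)
          (sum_sigma_ite (fun a => G.head a = d) fun l' =>
            θ l (Sum.inl (Sum.inl l')) * C.signal m k' l'.1 l'.2).symm h2.symm)
      -- Each equation sums to zero, so `-R` is the contribution of the unavailable data; the
      -- weights `D u₀` then isolate `u₀`.
      have hRl' : ∀ l, -R (fun a => C.signal m k' a.1) l =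
          ∑ u, if unitNode (Fin Rs) (fun l : Σ e, Fin (z e) => G.head l.1)
            (fun k : Σ v, Fin (Rw v) => k.1) s u = d
            then 0 else θ l u * unitValue (C.signal m k') k' m u := by
        intro l
        rw [neg_eq_iff_add_eq_zero, hRl, ← Finset.sum_add_distrib]
        refine (Finset.sum_congr rfl fun u _ => ?_).trans (hsig m k' l)
        split_ifs <;> simp
      rw [← Finset.sum_neg_distrib]
      simp only [← mul_neg, hRl', Finset.mul_sum]
      rw [Finset.sum_comm, Fintype.sum_eq_single u₀]
      · simp only [hu₀, if_false, ← mul_assoc, ← Finset.sum_mul, hD₁ u₀ hu₀, one_mul]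
      · intro u hu
        by_cases hud : unitNode (Fin Rs) (fun l : Σ e, Fin (z e) => G.head l.1)
            (fun k : Σ v, Fin (Rw v) => k.1) s u = d
        · simp [hud]
        · simp only [hud, if_false, ← mul_assoc, ← Finset.sum_mul, hD₀ u₀ hu₀ u hud hu, zero_mul]
    rw [hCdec, hrec]
    refine Prod.ext ?_ ?_
    · funext j
      exact key (Sum.inr j) hsd
    · funext v j
      exact (key (Sum.inl (Sum.inr ⟨v.1, j⟩)) v.2).trans (congrFun (hk' v.1 v.2).symm j)
  · intro A hA
    refine C.masks_of_exists_key hG hadd A fun m => ?_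
    -- The message terms go to the right-hand side; links and keys are both unknowns, and
    -- `eq_signal` identifies the link part with the signals of the key part.
    obtain ⟨y, hy, hyA⟩ := hsec A hA fun l => -∑ j, θ l (Sum.inr j) * m j
    let x : ∀ e, Fin (z e) → F := fun e i => y (Sum.inl ⟨e, i⟩)
    let k : ∀ v, Fin (Rw v) → F := fun v i => y (Sum.inr ⟨v, i⟩)
    have hx : x = C.signal m k := by
      refine C.eq_signal hG m k x fun e => ?_
      rw [hCenc]
      funext i
      rw [eq_linearEnc_iff G hG s θ hθ hdiag, Fintype.sum_sum_type]
      have h1 := hy ⟨e, i⟩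
      rw [eq_neg_iff_add_eq_zero] at h1
      rw [← h1]
      congr 1
      refine Finset.sum_congr rfl fun j _ => ?_
      rcases j with l | k <;> rfl
    refine ⟨k, fun e he => ?_⟩
    rw [← hx]
    funext i
    exact hyA ⟨e, i⟩ he

end LinearCodes

/-! ### Flow inequalities on the original links -/

section Feasibility

variable {V E : Type*} [Fintype V] [Fintype E] [DecidableEq V] [DecidableEq E]

-- The flow on a link is shared equally by its unit links. A link with `z e = 0` has none, and
-- carries no flow since `0 ≤ f e ≤ z e`.
omit [Fintype V] [DecidableEq E] in
theorem sum_unit_div (z : E → ℕ) (f : E → ℝ) (hf₀ : ∀ e, 0 ≤ f e) (hf : ∀ e, f e ≤ z e)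
    (g : E → V) (v : V) :
    ∑ l : Σ e, Fin (z e) with g l.1 = v, f l.1 / z l.1 = ∑ e with g e = v, f e := by
  rw [Finset.sum_filter, Finset.sum_filter, Fintype.sum_sigma]
  refine Finset.sum_congr rfl fun e _ => ?_
  split_ifs
  · change ∑ _i : Fin (z e), f e / z e = f e
    rw [Finset.sum_const, Finset.card_univ, Fintype.card_fin, nsmul_eq_mul]
    rcases Nat.eq_zero_or_pos (z e) with h | h
    · have h1 := hf e
      rw [h, Nat.cast_zero] at h1
      simp [h, le_antisymm h1 (hf₀ e)]
    · have : (z e : ℝ) ≠ 0 := by positivity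
      field_simp
  · simp

theorem sum_unit_key (Rw : V → ℕ) (v : V) :
    ∑ k : Σ v, Fin (Rw v) with k.1 = v, (1 : ℝ) = Rw v := by
  rw [Finset.sum_filter, Fintype.sum_sigma, Fintype.sum_eq_single v]
  · simp
  · intro w hw
    simp [hw]

omit [Fintype V] in
theorem netOut_augment_node (G : Network V E) (W : Finset (Finset E)) (f : AugLink W → ℝ)
    (v : V) : (G.augment W).netOut f (Sum.inl v) =
      ∑ e with G.tail e = v, f (Sum.inl e) - ∑ e with G.head e = v, f (Sum.inr (Sum.inl e)) := by
  simp only [Network.netOut, Finset.sum_filter, Fintype.sum_sum_type]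
  simp [Network.augment]

omit [Fintype V] in
theorem netOut_augment_link (G : Network V E) (W : Finset (Finset E)) (f : AugLink W → ℝ)
    (e : E) : (G.augment W).netOut f (Sum.inr (Sum.inl e)) =
      f (Sum.inr (Sum.inl e)) + ∑ t : (Σ A : {A // A ∈ W}, {e // e ∈ A.1}) with t.2.1 = e,
        f (Sum.inr (Sum.inr t)) - f (Sum.inl e) := by
  simp only [Network.netOut, Finset.sum_filter, Fintype.sum_sum_type]
  simp [Network.augment]

omit [Fintype V] in
theorem netOut_augment_sink (G : Network V E) (W : Finset (Finset E)) (f : AugLink W → ℝ)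
    (A : {A // A ∈ W}) : (G.augment W).netOut f (virtualSink V A) =
      -∑ e : {e // e ∈ A.1}, f (Sum.inr (Sum.inr ⟨A, e⟩)) := by
  have h : ∑ t : (Σ A : {A // A ∈ W}, {e // e ∈ A.1}),
      (if t.1 = A then f (Sum.inr (Sum.inr t)) else 0) =
      ∑ e : {e // e ∈ A.1}, f (Sum.inr (Sum.inr ⟨A, e⟩)) := by
    rw [Fintype.sum_sigma, Fintype.sum_eq_single A]
    · simp
    · intro B hB
      simp [hB]
  rw [← h]
  simp only [Network.netOut, Finset.sum_filter, Fintype.sum_sum_type]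
  simp [Network.augment]

variable {G : Network V E} {W : Finset (Finset E)} {c : E → ℝ} {s d : V} {Rs : ℝ} {Rw : V → ℝ}
  {z : E → ℝ} {fA : {A // A ∈ W} → AugLink W → ℝ} {fd : E → ℝ}

/-- The second half of a link carries at most what the first half carries. -/
theorem Feasible.second_half_le (h : Feasible G W c s d Rs Rw z fA fd) (A : {A // A ∈ W})
    (e : E) : fA A (Sum.inr (Sum.inl e)) ≤ fA A (Sum.inl e) := by
  have h1 := h.wiretap_other A (Sum.inr (Sum.inl e)) (by simp)
  have h2 : 0 ≤ ∑ t : (Σ A : {A // A ∈ W}, {e // e ∈ A.1}) with t.2.1 = e,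
      fA A (Sum.inr (Sum.inr t)) := Finset.sum_nonneg fun t _ => h.fA_nonneg A _
  rw [netOut_augment_link] at h1
  simp only [augKeyRate, Sum.elim_inr] at h1
  linarith

/-- A link observed by the wiretapper delivers its full rate to the virtual sink. -/
theorem Feasible.second_half_add_le (h : Feasible G W c s d Rs Rw z fA fd) (A : {A // A ∈ W})
    (e : E) (he : e ∈ A.1) : fA A (Sum.inr (Sum.inl e)) + z e ≤ fA A (Sum.inl e) := by
  have h1 := h.wiretap_other A (Sum.inr (Sum.inl e)) (by simp)
  rw [netOut_augment_link] at h1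
  simp only [augKeyRate, Sum.elim_inr] at h1
  have h2 : fA A (Sum.inr (Sum.inr ⟨A, e, he⟩)) ≤
      ∑ t : (Σ A : {A // A ∈ W}, {e // e ∈ A.1}) with t.2.1 = e, fA A (Sum.inr (Sum.inr t)) :=
    Finset.single_le_sum (f := fun t => fA A (Sum.inr (Sum.inr t)))
      (fun t _ => h.fA_nonneg A _) (by simp)
  have h3 := h.wiretap_sink A
  rw [netOut_augment_sink, neg_inj, ← Finset.sum_coe_sort A.1 z] at h3
  -- The inflow at the virtual sink equals the total capacity of its incoming links, so each of them
  -- is saturated.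
  have h4 : ∑ e : {e // e ∈ A.1}, (z e.1 - fA A (Sum.inr (Sum.inr ⟨A, e⟩))) = 0 := by
    rw [Finset.sum_sub_distrib, h3, sub_self]
  have h5 := (Finset.sum_eq_zero_iff_of_nonneg fun e _ =>
    sub_nonneg.2 (h.fA_le A (Sum.inr (Sum.inr ⟨A, e⟩)))).1 h4 ⟨e, he⟩ (Finset.mem_univ _)
  change z e - fA A (Sum.inr (Sum.inr ⟨A, e, he⟩)) = 0 at h5
  linarith

end Feasibility

/-! ### Codes for integral feasible points -/

/-- An integral feasible point yields linear codes over all sufficiently large finite fields. -/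
theorem exists_masking_linear_code {V E : Type*} [Fintype V] [Fintype E] [DecidableEq V]
    [DecidableEq E] (G : Network V E) (hG : G.Acyclic) (s d : V) (hsd : s ≠ d)
    (c : E → ℝ) (W : Finset (Finset E)) (Rs : ℕ) (Rw : V → ℕ) (z : E → ℕ)
    (fA : {A // A ∈ W} → AugLink W → ℝ) (fd : E → ℝ)
    (h : Feasible G W c s d (Rs : ℝ) (fun v => (Rw v : ℝ)) (fun e => (z e : ℝ)) fA fd) :
    ∃ q₀ : ℕ, ∀ (F : Type*) [Field F] [Fintype F], q₀ ≤ Fintype.card F →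
      ∃ C : NetworkCode G s d
          (Fin Rs → F) (fun v => Fin (Rw v) → F) (fun e => Fin (z e) → F),
        C.IsLinear F ∧ C.SinkDecodes ∧ ∀ A ∈ W, C.Masks A := by
  obtain ⟨q₀, hq⟩ := exists_generic_coefficients (M := Fin Rs)
    (fun l : Σ e, Fin (z e) => G.tail l.1) (fun l => G.head l.1)
    (fun k : Σ v, Fin (Rw v) => k.1) s d
    (fun A : {A // A ∈ W} => Finset.univ.filter fun l => l.1 ∈ A.1)
    (by
      intro A
      have hpos : ∀ l : Σ e, Fin (z e), (0 : ℝ) < z l.1 := fun l => by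
        exact_mod_cast (Nat.zero_le _).trans_lt l.2.2
      refine exists_secrecy_matching _ _ _ s _ (fun l => fA A (Sum.inl l.1) / z l.1)
        (fun l => fA A (Sum.inr (Sum.inl l.1)) / z l.1)
        (fun l => div_nonneg (h.fA_nonneg A _) (hpos l).le)
        (fun l => (div_le_one (hpos l)).2 (h.fA_le A (Sum.inl l.1)))
        (fun l => div_le_div_of_nonneg_right (h.second_half_le A l.1) (hpos l).le)
        (fun l hl => ?_) (fun v => ?_)
      · rw [div_add_one (hpos l).ne']
        exact div_le_div_of_nonneg_right
          (h.second_half_add_le A l.1 (Finset.mem_filter.1 hl).2) (hpos l).le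
      · rw [sum_unit_div z (fun e => fA A (Sum.inl e)) (fun e => h.fA_nonneg A _)
          (fun e => h.fA_le A (Sum.inl e)) G.tail v,
          sum_unit_div z (fun e => fA A (Sum.inr (Sum.inl e))) (fun e => h.fA_nonneg A _)
          (fun e => h.fA_le A (Sum.inr (Sum.inl e))) G.head v, sum_unit_key]
        have h1 := h.wiretap_other A (Sum.inl v) (by simp)
        rw [netOut_augment_node] at h1
        simp only [augKeyRate, Sum.elim_inl] at h1
        linarith)
    (by
      refine exists_decoding_matching _ _ _ s d (fun l => fd l.1 / z l.1)
        (fun l => div_nonneg (h.fd_nonneg _) (Nat.cast_nonneg _))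
        (fun l => div_le_one_of_le₀ (h.fd_le _) (Nat.cast_nonneg _)) fun v hv => ?_
      rw [sum_unit_div z fd h.fd_nonneg h.fd_le G.head v,
        sum_unit_div z fd h.fd_nonneg h.fd_le G.tail v, sum_unit_key]
      by_cases hs : s = v
      · subst hs
        have h1 := h.source
        rw [Network.netOut] at h1
        simp only [if_true, Finset.sum_const, Finset.card_univ, Fintype.card_fin, nsmul_eq_mul,
          mul_one]
        linarith
      · have h1 := h.other v hv (Ne.symm hs)
        rw [Network.netOut] at h1
        simp only [hs, if_false, Finset.sum_const_zero]
        linarith)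
  refine ⟨q₀, fun F _ _ hF => ?_⟩
  obtain ⟨θ, hθ, hdiag, hsec, hdec⟩ := hq F hF
  refine exists_linear_code G hG s d hsd W θ hθ hdiag (fun A hA rhs => ?_) hdec
  obtain ⟨y, hy, hyA⟩ := hsec ⟨A, hA⟩ rhs
  exact ⟨y, hy, fun l hl => hyA l (by simpa using hl)⟩

/-! ### From masking to zero mutual information -/

section Secrecy

variable {V E : Type*} [Fintype V] [DecidableEq V] [DecidableEq E]
    {G : Network V E} {s d : V} {M : Type*} {K : V → Type*} {X : E → Type*}
    [Fintype M] [∀ v, Fintype (K v)] [∀ e, Fintype (X e)]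

/-- Each term has logarithm of `1`, or else weight `0`, which makes the value of the undefined
quotient irrelevant. -/
theorem mutualInfo_eq_zero {Ω α β : Type*} [Fintype Ω] [Fintype α] [Fintype β]
    (P : Ω → ℝ) (Y : Ω → α) (Z : Ω → β)
    (h : ∀ a b, prob P (fun ω => Y ω = a ∧ Z ω = b) =
      prob P (fun ω => Y ω = a) * prob P (fun ω => Z ω = b)) : mutualInfo P Y Z = 0 := by
  refine Finset.sum_eq_zero fun a _ => Finset.sum_eq_zero fun b _ => ?_
  rw [h]
  by_cases h0 : prob P (fun ω => Y ω = a) * prob P (fun ω => Z ω = b) = 0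
  · rw [h0, zero_mul]
  · rw [div_self h0, Real.logb_one, mul_zero]

omit [DecidableEq E] [∀ e, Fintype (X e)] in
theorem prob_jointLaw (p : M → ℝ) (S : M × (∀ v, K v) → Prop) :
    prob (jointLaw (K := K) p) S = ∑ m, p m * prob (fun _ : ∀ v, K v =>
      (Fintype.card (∀ v, K v) : ℝ)⁻¹) fun k => S (m, k) := by
  classical
  simp only [prob, Finset.sum_filter, jointLaw, Fintype.sum_prod_type, Finset.mul_sum, mul_ite,
    mul_zero]

/-- If the keys mask the message on `A`, then the symbols on `A` are independent of it. -/
theorem NetworkCode.Masks.perfectlySecret {C : NetworkCode G s d M K X} {A : Finset E}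
    (h : C.Masks A) (hK : ∀ v, Nonempty (K v)) : C.PerfectlySecret A := by
  classical
  intro p hp
  refine mutualInfo_eq_zero _ _ _ fun m₀ b => ?_
  let u : (∀ v, K v) → ℝ := fun _ => (Fintype.card (∀ v, K v) : ℝ)⁻¹
  let B : M → (∀ v, K v) → Prop := fun m k =>
    (fun e : {e // e ∈ A} => C.signal m k e.1) = b
  -- The masking permutation preserves the uniform law of the keys, so the conditional law of the
  -- observation does not depend on the message.
  have hB : ∀ m, prob u (B m) = prob u (B m₀) := by
    intro m
    obtain ⟨π, hπ⟩ := h m₀ m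
    have h1 : ∀ k, B m (π k) ↔ B m₀ k := fun k => by
      have : (fun e : {e // e ∈ A} => C.signal m (π k) e.1) =
          fun e : {e // e ∈ A} => C.signal m₀ k e.1 :=
        funext fun e => hπ k e.1 e.2
      simp only [B, this]
    simp only [prob, Finset.sum_filter]
    rw [← Equiv.sum_comp π]
    simp only [h1, u]
  have hu : ∀ m, prob u (fun _ => m = m₀) = if m = m₀ then 1 else 0 := by
    intro m
    by_cases hm : m = m₀
    · have : (Fintype.card (∀ v, K v) : ℝ) ≠ 0 := by
        exact_mod_cast Fintype.card_ne_zero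
      simp [prob, u, hm]
      field_simp
    · simp [prob, hm]
  have hZ : prob (jointLaw (K := K) p) (fun ω => B ω.1 ω.2) = prob u (B m₀) := by
    rw [prob_jointLaw]
    change ∑ m, p m * prob u (B m) = _
    simp only [hB]
    rw [← Finset.sum_mul, hp.2, one_mul]
  have hY : prob (jointLaw (K := K) p) (fun ω => ω.1 = m₀) = p m₀ := by
    rw [prob_jointLaw]
    change ∑ m, p m * prob u (fun _ => m = m₀) = _
    simp [hu]
  have hYZ : prob (jointLaw (K := K) p) (fun ω => ω.1 = m₀ ∧ B ω.1 ω.2) =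
      p m₀ * prob u (B m₀) := by
    rw [prob_jointLaw]
    change ∑ m, p m * prob u (fun k => m = m₀ ∧ B m k) = _
    rw [Fintype.sum_eq_single m₀]
    · simp
    · intro m hm
      simp [prob, hm]
  change prob (jointLaw (K := K) p) (fun ω => ω.1 = m₀ ∧ B ω.1 ω.2) =
    prob (jointLaw (K := K) p) (fun ω => ω.1 = m₀) *
      prob (jointLaw (K := K) p) (fun ω => B ω.1 ω.2)
  rw [hYZ, hY, hZ]

end Secrecy

/-! ### Relabelling of alphabets -/

section Transport

variable {V E : Type*} {G : Network V E} {s d : V} {M M' : Type*} {K K' : V → Type*}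
  {X X' : E → Type*}

/-- Relabelling of the alphabets of a code. -/
def NetworkCode.relabel (C : NetworkCode G s d M K X) (fM : M ≃ M') (fK : ∀ v, K v ≃ K' v)
    (fX : ∀ e, X e ≃ X' e) : NetworkCode G s d M' K' X' where
  enc e t := fX e (C.enc e (fun h => fM.symm (t.1 h), (fK _).symm t.2.1,
    fun a => (fX a.1).symm (t.2.2 a)))
  signal m k e := fX e (C.signal (fM.symm m) (fun v => (fK v).symm (k v)) e)
  signal_eq m k e := by
    rw [C.signal_eq]
    simp
  dec r := (fM (C.dec fun a => (fX a.1).symm (r a)).1,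
    fun v => fK v.1 ((C.dec fun a => (fX a.1).symm (r a)).2 v))

theorem NetworkCode.SinkDecodes.relabel {C : NetworkCode G s d M K X} (h : C.SinkDecodes)
    (fM : M ≃ M') (fK : ∀ v, K v ≃ K' v) (fX : ∀ e, X e ≃ X' e) :
    (C.relabel fM fK fX).SinkDecodes := by
  intro m k
  have h1 := h (fM.symm m) (fun v => (fK v).symm (k v))
  simp [NetworkCode.relabel, h1]

theorem NetworkCode.Masks.relabel {C : NetworkCode G s d M K X} {A : Finset E} (h : C.Masks A)
    (fM : M ≃ M') (fK : ∀ v, K v ≃ K' v) (fX : ∀ e, X e ≃ X' e) :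
    (C.relabel fM fK fX).Masks A := by
  intro m m'
  obtain ⟨π, hπ⟩ := h (fM.symm m) (fM.symm m')
  let f : (∀ v, K v) ≃ (∀ v, K' v) := Equiv.piCongrRight fK
  refine ⟨f.symm.trans (π.trans f), fun k e he => ?_⟩
  have h1 := hπ (f.symm k) e he
  have h2 : (fun v => (fK v).symm (f (π (f.symm k)) v)) = π (f.symm k) := by
    funext v
    simp [f]
  simp only [NetworkCode.relabel, Equiv.trans_apply, h2, h1]
  rfl

end Transport

/-! ### Additive rational approximation -/

/-- Finitely many reals are simultaneously approximated by a `ℚ`-linear map to `ℚ`. -/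
theorem exists_rational_approximation {ι : Type*} [Fintype ι] (a : ι → ℝ) {δ : ℝ} (hδ : 0 < δ) :
    ∃ φ : ℝ →ₗ[ℚ] ℚ, ∀ i, |(φ (a i) : ℝ) - a i| ≤ δ := by
  classical
  -- Each vector of a Hamel basis is moved to a rational within `η`; the error at `a i` is then at
  -- most `η` times the sum `B i` of the absolute values of its coordinates.
  let b := Module.Basis.ofVectorSpace ℚ ℝ
  let B : ι → ℝ := fun i => ∑ j ∈ (b.repr (a i)).support, |(b.repr (a i) j : ℝ)|
  have hB : ∀ i, 0 ≤ B i := fun i => Finset.sum_nonneg fun j _ => abs_nonneg _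
  have hsum : 0 ≤ ∑ i, B i := Finset.sum_nonneg fun i _ => hB i
  let η : ℝ := δ / (1 + ∑ i, B i)
  have hη : 0 < η := by positivity
  have hr : ∀ j, ∃ r : ℚ, |(r : ℝ) - b j| < η := fun j => by
    obtain ⟨r, hr⟩ := exists_rat_near (b j) hη
    exact ⟨r, by rwa [abs_sub_comm]⟩
  choose r hr using hr
  refine ⟨b.constr ℚ r, fun i => ?_⟩
  have h1 : ((b.constr ℚ r (a i) : ℚ) : ℝ) =
      ∑ j ∈ (b.repr (a i)).support, (b.repr (a i) j : ℝ) * r j := by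
    simp only [Module.Basis.constr_apply, Finsupp.sum, smul_eq_mul, Rat.cast_sum, Rat.cast_mul]
  have h2 : a i = ∑ j ∈ (b.repr (a i)).support, (b.repr (a i) j : ℝ) * b j := by
    conv_lhs => rw [← b.linearCombination_repr (a i), Finsupp.linearCombination_apply, Finsupp.sum]
    exact Finset.sum_congr rfl fun j _ => Rat.smul_def _ _
  have h3 : ((b.constr ℚ r (a i) : ℚ) : ℝ) - a i =
      ∑ j ∈ (b.repr (a i)).support, (b.repr (a i) j : ℝ) * (r j - b j) := by
    simp only [mul_sub, Finset.sum_sub_distrib]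
    rw [h1, ← h2]
  rw [h3]
  calc |∑ j ∈ (b.repr (a i)).support, (b.repr (a i) j : ℝ) * (r j - b j)|
      ≤ ∑ j ∈ (b.repr (a i)).support, |(b.repr (a i) j : ℝ) * (r j - b j)| :=
        Finset.abs_sum_le_sum_abs _ _
    _ ≤ ∑ j ∈ (b.repr (a i)).support, |(b.repr (a i) j : ℝ)| * η :=
        Finset.sum_le_sum fun j _ => by
          rw [abs_mul]
          exact mul_le_mul_of_nonneg_left (hr j).le (abs_nonneg _)
    _ = B i * η := (Finset.sum_mul _ _ _).symm
    _ ≤ (1 + ∑ i, B i) * η := by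
        refine mul_le_mul_of_nonneg_right ?_ hη.le
        have := Finset.single_le_sum (fun i _ => hB i) (Finset.mem_univ i)
        linarith
    _ = δ := by
        simp only [η]
        field_simp

theorem exists_pos_le_of_pos {ι : Type*} [Finite ι] (a : ι → ℝ) :
    ∃ m : ℝ, 0 < m ∧ ∀ i, 0 < a i → m ≤ a i := by
  rcases isEmpty_or_nonempty {i // 0 < a i} with h | h
  · exact ⟨1, one_pos, fun i hi => (h.false ⟨i, hi⟩).elim⟩
  · obtain ⟨i₀, hi₀⟩ := Finite.exists_min fun i : {i // 0 < a i} => a i.1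
    exact ⟨a i₀.1, i₀.2, fun i hi => hi₀ ⟨i, hi⟩⟩

/-- Finitely many non-negative reals are approximated from below by an additive map whose values
on them are natural numbers divided by a common denominator `N`. -/
theorem exists_integral_approximation {ι : Type*} [Fintype ι] (a : ι → ℝ) (ha : ∀ i, 0 ≤ a i)
    {ε : ℝ} (hε : 0 < ε) :
    ∃ N : ℕ, 0 < N ∧ ∃ ψ : ℝ →+ ℝ, ∀ i, ∃ k : ℕ, ψ (a i) = k ∧ (k : ℝ) ≤ N * a i ∧
      N * (a i - ε) ≤ k := by
  classical
  obtain ⟨m, hm, hma⟩ := exists_pos_le_of_pos a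
  have hsum : 0 ≤ ∑ i, a i := Finset.sum_nonneg fun i _ => ha i
  have hpos : 0 < min 1 (ε / (2 * (1 + ∑ i, a i))) := lt_min one_pos (by positivity)
  obtain ⟨η, hη₀, hη₁⟩ := exists_rat_btwn hpos
  have hη₂ : (η : ℝ) < 1 := hη₁.trans_le (min_le_left _ _)
  have hη₃ : ∀ i, 2 * (η : ℝ) * a i ≤ ε := by
    intro i
    have h1 : (η : ℝ) * (2 * (1 + ∑ i, a i)) ≤ ε :=
      (le_div_iff₀ (by positivity)).1 (hη₁.le.trans (min_le_right _ _))
    have h2 : a i ≤ ∑ i, a i := Finset.single_le_sum (fun i _ => ha i) (Finset.mem_univ i)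
    have h3 : (η : ℝ) * a i ≤ η * (1 + ∑ i, a i) :=
      mul_le_mul_of_nonneg_left (by linarith) hη₀.le
    linarith
  -- Since `m` bounds the positive `a i` from below, the relative error there is at most `η`; zeros
  -- stay zero by linearity. The factor `1 - η` in `y` brings values below `a i`, as `(1 - η)(1 + η)
  -- ≤ 1`, and costs at most `2 * η * a i ≤ ε`, as `(1 - η)² ≥ 1 - 2 * η`.
  obtain ⟨φ, hφ⟩ := exists_rational_approximation a (δ := η * m) (by positivity)
  let y : ι → ℚ := fun i => (1 - η) * φ (a i)
  have hy : ∀ i, 0 ≤ (y i : ℝ) ∧ (y i : ℝ) ≤ a i ∧ a i - ε ≤ y i := by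
    intro i
    rcases (ha i).eq_or_lt with h0 | h0
    · have : y i = 0 := by simp [y, ← h0]
      rw [this, ← h0]
      simp [hε.le]
    · have h1 := abs_le.1 (hφ i)
      have h2 : (η : ℝ) * m ≤ η * a i := mul_le_mul_of_nonneg_left (hma i h0) hη₀.le
      have h3 : (1 - η) * a i ≤ (φ (a i) : ℝ) := by linarith [h1.1]
      have h4 : (φ (a i) : ℝ) ≤ (1 + η) * a i := by linarith [h1.2]
      have h5 : (0 : ℝ) ≤ 1 - η := by linarith
      have h6 : (1 - (η : ℝ)) * ((1 - η) * a i) ≤ (1 - η) * φ (a i) :=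
        mul_le_mul_of_nonneg_left h3 h5
      have h7 : (1 - (η : ℝ)) * φ (a i) ≤ (1 - η) * ((1 + η) * a i) :=
        mul_le_mul_of_nonneg_left h4 h5
      have h8 : 0 ≤ (η : ℝ) ^ 2 * a i := by positivity
      have h9 := hη₃ i
      have h10 : 0 ≤ (1 - (η : ℝ)) * ((1 - η) * a i) := by positivity
      simp only [y]
      push_cast
      exact ⟨by linarith, by linarith, by linarith⟩
  let N : ℕ := ∏ i, (y i).den
  have hN : 0 < N := Finset.prod_pos fun i _ => (y i).den_pos
  refine ⟨N, hN, (AddMonoidHom.mulLeft ((N : ℝ) * (1 - η))).comp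
    ((Rat.castHom ℝ).toAddMonoidHom.comp φ.toAddMonoidHom), fun i => ?_⟩
  have hψ : (AddMonoidHom.mulLeft ((N : ℝ) * (1 - η))).comp
      ((Rat.castHom ℝ).toAddMonoidHom.comp φ.toAddMonoidHom) (a i) = N * (y i : ℝ) := by
    simp [y, mul_assoc]
  obtain ⟨t, ht⟩ := Finset.dvd_prod_of_mem (fun i => (y i).den) (Finset.mem_univ i)
  have hNt : (N : ℝ) = (y i).den * t := by exact_mod_cast ht
  have hnum : 0 ≤ (y i).num := Rat.num_nonneg.2 (by exact_mod_cast (hy i).1)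
  have hk : ((t * (y i).num.toNat : ℕ) : ℝ) = N * (y i : ℝ) := by
    have h1 : (((y i).num.toNat : ℕ) : ℝ) = ((y i).num : ℝ) := by
      exact_mod_cast congrArg (Int.cast (R := ℝ)) (Int.toNat_of_nonneg hnum)
    have h2 : ((y i).den : ℝ) * (y i : ℝ) = (y i).num := by
      exact_mod_cast Rat.den_mul_eq_num (y i)
    rw [hNt, Nat.cast_mul, h1, ← h2]
    ring
  refine ⟨t * (y i).num.toNat, by rw [hψ, hk], ?_, ?_⟩
  · rw [hk]
    exact mul_le_mul_of_nonneg_left (hy i).2.1 (Nat.cast_nonneg _)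
  · rw [hk]
    exact mul_le_mul_of_nonneg_left (hy i).2.2 (Nat.cast_nonneg _)

/-! ### Integral approximation of feasible points -/

section Scaling

variable {V E : Type*} [Fintype V] [Fintype E] [DecidableEq V] [DecidableEq E]
  {G : Network V E} {W : Finset (Finset E)} {c : E → ℝ} {s d : V} {Rs : ℝ} {Rw : V → ℝ}
  {z : E → ℝ} {fA : {A // A ∈ W} → AugLink W → ℝ} {fd : E → ℝ}

omit [Fintype V] [DecidableEq E] in
theorem map_netOut (ψ : ℝ →+ ℝ) (f : E → ℝ) (v : V) :
    ψ (G.netOut f v) = G.netOut (fun e => ψ (f e)) v := by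
  simp only [Network.netOut, map_sub, map_sum]

omit [Fintype V] [Fintype E] [DecidableEq V] [DecidableEq E] in
theorem map_augKeyRate (ψ : ℝ →+ ℝ) (i : AugNode V W) :
    ψ (augKeyRate W Rw i) = augKeyRate W (fun v => ψ (Rw v)) i := by
  rcases i with v | i
  · rfl
  · exact map_zero ψ

omit [Fintype E] [DecidableEq E] in
theorem map_augCap (ψ : ℝ →+ ℝ) (l : AugLink W) :
    ψ (augCap W z l) = augCap W (fun e => ψ (z e)) l := by
  rcases l with e | e | t <;> rfl

/-- A feasible point is approximated by an integral one after scaling. -/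
theorem Feasible.exists_integral (h : Feasible G W c s d Rs Rw z fA fd) {ε : ℝ} (hε : 0 < ε) :
    ∃ N : ℕ, 0 < N ∧ ∃ (Rs' : ℕ) (Rw' : V → ℕ) (z' : E → ℕ)
      (fA' : {A // A ∈ W} → AugLink W → ℝ) (fd' : E → ℝ),
      Feasible G W (fun e => (z' e : ℝ)) s d Rs' (fun v => (Rw' v : ℝ)) (fun e => (z' e : ℝ))
        fA' fd' ∧
      ((Rs' : ℝ) ≤ N * Rs ∧ N * (Rs - ε) ≤ Rs') ∧
      (∀ v, (Rw' v : ℝ) ≤ N * Rw v ∧ N * (Rw v - ε) ≤ Rw' v) ∧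
      ∀ e, (z' e : ℝ) ≤ N * z e := by
  -- At the virtual sink itself, where no bound is imposed, the slack is `∑ e ∈ A, z e`, so all
  -- nodes can be treated alike.
  have hslack : ∀ A i, 0 ≤ augKeyRate W Rw i - (G.augment W).netOut (fA A) i := by
    intro A i
    by_cases hi : i = virtualSink V A
    · rw [hi, h.wiretap_sink, sub_neg_eq_add]
      exact add_nonneg le_rfl (Finset.sum_nonneg fun e _ => h.z_nonneg e)
    · exact sub_nonneg.2 (h.wiretap_other A i hi)
  -- All variables and all slacks are approximated together: additivity of `ψ` keeps the equations,
  -- and its non-negative values on the slacks keep the inequalities. The capacities `c` are left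
  -- out, since the new rates serve as their own capacities.
  obtain ⟨N, hN, ψ, hψ⟩ := exists_integral_approximation
    (ι := (Unit ⊕ V ⊕ E) ⊕ (({A // A ∈ W} × AugLink W) ⊕ E) ⊕
      ({A // A ∈ W} × AugNode V W) ⊕ ({A // A ∈ W} × AugLink W) ⊕ E)
    (Sum.elim (Sum.elim (fun _ => Rs) (Sum.elim Rw z))
      (Sum.elim (Sum.elim (fun p => fA p.1 p.2) fd)
        (Sum.elim (fun p => augKeyRate W Rw p.2 - (G.augment W).netOut (fA p.1) p.2)
          (Sum.elim (fun p => augCap W z p.2 - fA p.1 p.2) fun e => z e - fd e))))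
    (by
      rintro ((_ | v | e) | (p | e) | p | p | e)
      exacts [h.Rs_nonneg, h.Rw_nonneg v, h.z_nonneg e, h.fA_nonneg _ _, h.fd_nonneg e,
        hslack _ _, sub_nonneg.2 (h.fA_le _ _), sub_nonneg.2 (h.fd_le e)]) hε
  choose k hk hk₁ hk₂ using hψ
  have hnn : ∀ i, 0 ≤ ψ _ := fun i => (hk i).symm ▸ Nat.cast_nonneg (k i)
  let Rs' := k (Sum.inl (Sum.inl ()))
  let Rw' := fun v => k (Sum.inl (Sum.inr (Sum.inl v)))
  let z' := fun e => k (Sum.inl (Sum.inr (Sum.inr e)))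
  have hRs : ψ Rs = (Rs' : ℝ) := hk (Sum.inl (Sum.inl ()))
  have hRw : (fun v => ψ (Rw v)) = fun v => (Rw' v : ℝ) :=
    funext fun v => hk (Sum.inl (Sum.inr (Sum.inl v)))
  have hz : (fun e => ψ (z e)) = fun e => (z' e : ℝ) :=
    funext fun e => hk (Sum.inl (Sum.inr (Sum.inr e)))
  refine ⟨N, hN, Rs', Rw', z', fun A l => ψ (fA A l), fun e => ψ (fd e), ?_,
    ⟨hk₁ (Sum.inl (Sum.inl ())), hk₂ (Sum.inl (Sum.inl ()))⟩,
    fun v => ⟨hk₁ (Sum.inl (Sum.inr (Sum.inl v))), hk₂ (Sum.inl (Sum.inr (Sum.inl v)))⟩,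
    fun e => hk₁ (Sum.inl (Sum.inr (Sum.inr e)))⟩
  rw [← hRs, ← hRw, ← hz]
  exact
    { Rs_nonneg := hnn (Sum.inl (Sum.inl ()))
      Rw_nonneg := fun v => hnn (Sum.inl (Sum.inr (Sum.inl v)))
      z_nonneg := fun e => hnn (Sum.inl (Sum.inr (Sum.inr e)))
      fA_nonneg := fun A l => hnn (Sum.inr (Sum.inl (Sum.inl (A, l))))
      fd_nonneg := fun e => hnn (Sum.inr (Sum.inl (Sum.inr e)))
      wiretap_sink := fun A => by
        rw [← map_netOut, h.wiretap_sink, map_neg, map_sum]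
      wiretap_other := fun A i _ => by
        have h1 : 0 ≤ ψ (augKeyRate W Rw i - (G.augment W).netOut (fA A) i) :=
          hnn (Sum.inr (Sum.inr (Sum.inl (A, i))))
        rw [map_sub, map_augKeyRate, map_netOut] at h1
        linarith
      sink := by rw [← map_netOut, h.sink, map_neg, map_add, map_sum]
      source := by rw [← map_netOut, h.source, map_add]
      other := fun i hd hs => by rw [← map_netOut, h.other i hd hs]
      fA_le := fun A l => by
        have h1 : 0 ≤ ψ (augCap W z l - fA A l) :=
          hnn (Sum.inr (Sum.inr (Sum.inr (Sum.inl (A, l)))))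
        rw [map_sub, map_augCap] at h1
        linarith
      fd_le := fun e => by
        have h1 : 0 ≤ ψ (z e - fd e) := hnn (Sum.inr (Sum.inr (Sum.inr (Sum.inr e))))
        rw [map_sub] at h1
        linarith
      z_le := fun e => le_rfl }

end Scaling

/-! ### Alphabet sizes -/

section AlphabetSize

variable {n N k : ℕ} {R ε : ℝ}

/-- A field symbol has `⌊n / N⌋` bits; rounding down favours the upper bound. -/
theorem alphabet_size_le (hR : 0 ≤ R) (hk : (k : ℝ) ≤ N * R) :
    (((2 ^ (n / N)) ^ k : ℕ) : ℝ) ≤ 2 ^ (n * R) := by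
  have h1 : (((2 ^ (n / N)) ^ k : ℕ) : ℝ) = 2 ^ (((n / N : ℕ) : ℝ) * k) := by
    rw [Real.rpow_mul zero_le_two, Real.rpow_natCast, Real.rpow_natCast]
    push_cast
    rfl
  rw [h1]
  refine Real.rpow_le_rpow_of_exponent_le one_le_two ?_
  have h2 : ((n / N : ℕ) : ℝ) * N ≤ n := by exact_mod_cast Nat.div_mul_le_self n N
  calc ((n / N : ℕ) : ℝ) * k ≤ ((n / N : ℕ) : ℝ) * (N * R) :=
        mul_le_mul_of_nonneg_left hk (Nat.cast_nonneg _)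
    _ = ((n / N : ℕ) : ℝ) * N * R := by ring
    _ ≤ n * R := mul_le_mul_of_nonneg_right h2 hR

/-- Half of `ε` pays for the approximation of `N * R` by `k`, the other half for rounding `n / N`,
which loses at most `N * R` bits. If `R ≤ ε / 2`, the left side is at most `1`. -/
theorem le_alphabet_size (hN : 0 < N) (hε : 0 < ε) (hk : N * (R - ε / 2) ≤ k)
    (hn : N * R ≤ n * (ε / 2)) :
    (2 : ℝ) ^ (n * (R - ε)) ≤ (((2 ^ (n / N)) ^ k : ℕ) : ℝ) := by
  have h1 : (((2 ^ (n / N)) ^ k : ℕ) : ℝ) = 2 ^ (((n / N : ℕ) : ℝ) * k) := by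
    rw [Real.rpow_mul zero_le_two, Real.rpow_natCast, Real.rpow_natCast]
    push_cast
    rfl
  rw [h1]
  refine Real.rpow_le_rpow_of_exponent_le one_le_two ?_
  have h0 : (0 : ℝ) ≤ n := Nat.cast_nonneg n
  rcases le_total (R - ε / 2) 0 with h | h
  · have h2 : (n : ℝ) * (R - ε) ≤ 0 := mul_nonpos_of_nonneg_of_nonpos h0 (by linarith)
    exact h2.trans (by positivity)
  · have h2 : (n : ℝ) ≤ ((n / N : ℕ) : ℝ) * N + N := by
      exact_mod_cast (Nat.lt_div_mul_add hN).le
    have h3 : ((n / N : ℕ) : ℝ) * (N * (R - ε / 2)) ≤ ((n / N : ℕ) : ℝ) * k :=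
      mul_le_mul_of_nonneg_left hk (Nat.cast_nonneg _)
    have h4 := mul_le_mul_of_nonneg_right h2 h
    have h5 : 0 ≤ (N : ℝ) * (ε / 2) := by positivity
    linarith

end AlphabetSize

end SecureNetwork

/-! ### The two statements on codes -/

theorem mainTheorem5 {V E : Type*} [Fintype V] [Fintype E] [DecidableEq V] [DecidableEq E]
    (G : SecureNetwork.Network V E) (hG : G.Acyclic) (s d : V) (hsd : s ≠ d)
    (c : E → ℝ) (W : Finset (Finset E)) :
    (∀ (Rs : ℕ) (Rw : V → ℕ) (z : E → ℕ)
        (fA : {A // A ∈ W} → SecureNetwork.AugLink W → ℝ) (fd : E → ℝ),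
      SecureNetwork.Feasible G W c s d (Rs : ℝ) (fun v => (Rw v : ℝ)) (fun e => (z e : ℝ)) fA fd →
      ∃ q₀ : ℕ, ∀ (F : Type*) [Field F] [Fintype F], q₀ ≤ Fintype.card F →
        ∃ C : SecureNetwork.NetworkCode G s d
            (Fin Rs → F) (fun v => Fin (Rw v) → F) (fun e => Fin (z e) → F),
          C.IsLinear F ∧ C.SinkDecodes ∧
            ∀ A ∈ W, C.PerfectlySecret A) ∧
    (∀ (Rs : ℝ) (Rw : V → ℝ) (z : E → ℝ)
        (fA : {A // A ∈ W} → SecureNetwork.AugLink W → ℝ) (fd : E → ℝ),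
      SecureNetwork.Feasible G W c s d Rs Rw z fA fd →
      ∀ ε : ℝ, 0 < ε → ∃ n₀ : ℕ, ∀ n : ℕ, n₀ ≤ n →
        ∃ (μ : ℕ) (κ : V → ℕ) (χ : E → ℕ),
          ((2 : ℝ) ^ (n * (Rs - ε)) ≤ μ ∧ (μ : ℝ) ≤ 2 ^ (n * Rs)) ∧
          (∀ v, (2 : ℝ) ^ (n * (Rw v - ε)) ≤ κ v ∧ (κ v : ℝ) ≤ 2 ^ (n * Rw v)) ∧
          (∀ e, (χ e : ℝ) ≤ 2 ^ (n * z e)) ∧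
          ∃ C : SecureNetwork.NetworkCode G s d
              (Fin μ) (fun v => Fin (κ v)) (fun e => Fin (χ e)),
            C.SinkDecodes ∧ ∀ A ∈ W, C.PerfectlySecret A) := by

  refine ⟨fun Rs Rw z fA fd h => ?_, fun Rs Rw z fA fd h ε hε => ?_⟩
  · obtain ⟨q₀, hq⟩ := SecureNetwork.exists_masking_linear_code G hG s d hsd c W Rs Rw z fA fd h
    refine ⟨q₀, fun F _ _ hF => ?_⟩
    obtain ⟨C, hlin, hdec, hmask⟩ := hq F hF
    exact ⟨C, hlin, hdec, fun A hA => (hmask A hA).perfectlySecret fun v => inferInstance⟩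
  · obtain ⟨N, hN, Rs', Rw', z', fA', fd', h', hRs, hRw, hz⟩ := h.exists_integral (half_pos hε)
    obtain ⟨q₀, hq⟩ := SecureNetwork.exists_masking_linear_code G hG s d hsd _ W Rs' Rw' z'
      fA' fd' h'
    -- The total rate bounds every single rate, so one threshold serves the message and all keys.
    obtain ⟨n₁, hn₁⟩ := exists_nat_ge (N * (Rs + ∑ v, Rw v) / (ε / 2))
    have hsum : 0 ≤ ∑ v, Rw v := Finset.sum_nonneg fun v _ => h.Rw_nonneg v
    -- This makes `n / N ≥ q₀ + 1`: the degree of the field is non-zero and its order `2 ^ (n / N)`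
    -- exceeds `q₀`.
    refine ⟨max n₁ (N * (q₀ + 1)), fun n hn => ?_⟩
    have hnm : q₀ + 1 ≤ n / N := by
      rw [Nat.le_div_iff_mul_le hN, mul_comm]
      exact (le_max_right _ _).trans hn
    have hnR : (N : ℝ) * (Rs + ∑ v, Rw v) ≤ n * (ε / 2) := by
      rw [← div_le_iff₀ (half_pos hε)]
      exact hn₁.trans (by exact_mod_cast (le_max_left _ _).trans hn)
    have hnR' : ∀ R, R ≤ Rs + ∑ v, Rw v → (N : ℝ) * R ≤ n * (ε / 2) := fun R hR =>
      (mul_le_mul_of_nonneg_left hR (Nat.cast_nonneg _)).trans hnR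
    let F := GaloisField 2 (n / N)
    let instF : Fintype F := Fintype.ofFinite F
    have hF : Fintype.card F = 2 ^ (n / N) := by
      rw [← Nat.card_eq_fintype_card]
      exact GaloisField.card 2 (n / N) (by omega)
    obtain ⟨C, -, hdec, hmask⟩ := hq F (by
      rw [hF]
      have := (n / N).lt_two_pow_self
      omega)
    have hcard : ∀ k, Fintype.card (Fin k → F) = (2 ^ (n / N)) ^ k := fun k => by
      rw [Fintype.card_fun, hF, Fintype.card_fin]
    let f : ∀ k, (Fin k → F) ≃ Fin ((2 ^ (n / N)) ^ k) := fun k =>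
      Fintype.equivFinOfCardEq (hcard k)
    refine ⟨(2 ^ (n / N)) ^ Rs', fun v => (2 ^ (n / N)) ^ Rw' v, fun e => (2 ^ (n / N)) ^ z' e,
      ⟨?_, ?_⟩, fun v => ⟨?_, ?_⟩, fun e => ?_,
      C.relabel (f Rs') (fun v => f (Rw' v)) (fun e => f (z' e)), hdec.relabel _ _ _,
      fun A hA => ((hmask A hA).relabel _ _ _).perfectlySecret fun v => ⟨⟨0, by positivity⟩⟩⟩
    · exact SecureNetwork.le_alphabet_size hN hε hRs.2 (hnR' _ (by linarith))
    · exact SecureNetwork.alphabet_size_le h.Rs_nonneg hRs.1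
    · refine SecureNetwork.le_alphabet_size hN hε (hRw v).2 (hnR' _ ?_)
      have := Finset.single_le_sum (fun v _ => h.Rw_nonneg v) (Finset.mem_univ v)
      have := h.Rs_nonneg
      linarith
    · exact SecureNetwork.alphabet_size_le (h.Rw_nonneg v) (hRw v).1
    · exact SecureNetwork.alphabet_size_le (h.z_nonneg e) (hz e)
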